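/- Let $p$ be a prime, $f\ge 1$, $q=p^f$, let $\mathbb{F}_q$ be the field with $q$ elements, $\lambda$ a generator of $\mathbb{F}_q^\ast$ and $\sigma:x\mapsto x^p$ the Frobenius automorphism. Let $\mathrm{A}\Gamma\mathrm{L}_1(q)$ be the group of all permutations $x\mapsto a\,x^\tau+b$ of $\mathbb{F}_q$ with $a\in\mathbb{F}_q^\ast$, $\tau\in\mathrm{Aut}(\mathbb{F}_q)$, $b\in\mathbb{F}_q$; let $V$ be its subgroup of translations, and identify $a\in\mathbb{F}_q^\ast=\mathrm{GL}_1(q)$ with the permutation $x\mapsto ax$. The normal covering number $\gamma(X)$ of a finite group $X$ is the smallest $k$ such that $X$ has proper subgroups $X_1,\dots,X_k$ with every element of $X$ conjugate in $X$ to an element of some $X_i$ ($\gamma(X)=\infty$ if there is no such $k$, that is, if $X$ is cyclic). A finite group $X$ is called non-basic (of affine type) if it has a unique minimal normal subgroup $N$, $N$ is abelian, $\gamma(X/N)\ne 2$ and $\gamma(X)\neq 2$. Let $G=V\rtimes H$ be a non-cyclic primitive subgroup of $\mathrm{A}\Gamma\mathrm{L}_1(q)$ containing $V$, where $H$ is the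 stabilizer of $0$ in $G$. Then $G$ is non-basic if and only if all of the following hold: 1. $p\equiv 3\pmod 4$; 2. $f=2$; 3. $H$ is a dihedral $2$-group, and $H$ is conjugate, by an element of $\mathrm{GL}_1(q)$, to $\langle\sigma,\lambda^{(p-1)e}\rangle$ for some divisor $e$ of $p+1$. -/

import Mathlib

/-- A normal `k`-covering of `G`: proper subgroups `H 0, …, H (k-1)` such that every element of `G`
is conjugate to an element of some `H i`. -/
def IsNormalCovering {G : Type*} [Group G] {k : ℕ} (H : Fin k → Subgroup G) : Prop :=
  (∀ i, H i ≠ ⊤) ∧ ∀ x : G, ∃ i, ∃ g : G, g * x * g⁻¹ ∈ H i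

/-- The normal covering number `γ(G)`: the smallest `k` such that `G` has a normal `k`-covering
(`⊤` if there is no such `k`, which for a finite group means that `G` is cyclic). -/
noncomputable def normalCoveringNumber (G : Type*) [Group G] : ℕ∞ :=
  sInf {m : ℕ∞ | ∃ k : ℕ, m = (k : ℕ∞) ∧ ∃ H : Fin k → Subgroup G, IsNormalCovering H}

/-- `N` is a minimal normal subgroup of `G`. -/
def IsMinimalNormal {G : Type*} [Group G] (N : Subgroup G) : Prop :=
  N.Normal ∧ N ≠ ⊥ ∧ ∀ M : Subgroup G, M.Normal → M ≠ ⊥ → M ≤ N → M = N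

/-- `G` is non-basic (of affine type): it has a unique minimal normal subgroup `V`, `V` is abelian,
`γ(G/V) ≠ 2` and `γ(G) ≠ 2`. -/
def IsNonBasicOfAffineType (G : Type*) [Group G] : Prop :=
  ∃ (V : Subgroup G) (_ : V.Normal),
    IsMinimalNormal V ∧ (∀ W : Subgroup G, IsMinimalNormal W → W = V) ∧
    (∀ x ∈ V, ∀ y ∈ V, x * y = y * x) ∧
    normalCoveringNumber (G ⧸ V) ≠ 2 ∧
    normalCoveringNumber G ≠ 2

/-- `G` is a finite dihedral group (of order `2n` for some `n ≥ 1`). -/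
def IsDihedral (G : Type*) [Group G] : Prop :=
  ∃ n : ℕ, 0 < n ∧ Nonempty (G ≃* DihedralGroup n)

/-- The group `V` of all translations `x ↦ x + b` of `F`. -/
def translationGroup (F : Type*) [Field F] : Subgroup (Equiv.Perm F) where
  carrier := {g | ∃ b : F, ∀ x, g x = x + b}
  one_mem' := ⟨0, fun x => by simp⟩
  mul_mem' := by
    rintro g h ⟨b, hg⟩ ⟨c, hh⟩
    exact ⟨c + b, fun x => by rw [Equiv.Perm.mul_apply, hg, hh, add_assoc]⟩
  inv_mem' := by
    rintro g ⟨b, hg⟩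
    exact ⟨-b, fun x => by rw [Equiv.Perm.inv_eq_iff_eq, hg]; ring⟩

/-- `AΓL₁(F)`, as the group of all permutations `x ↦ a * τ x + b` of `F` with `a ∈ Fˣ`,
`τ ∈ Aut F` and `b ∈ F`. -/
def affineSemilinearGroup (F : Type*) [Field F] : Subgroup (Equiv.Perm F) where
  carrier := {g | ∃ (a : Fˣ) (τ : F ≃+* F) (b : F), ∀ x, g x = a * τ x + b}
  one_mem' := ⟨1, RingEquiv.refl F, 0, fun x => by simp⟩
  mul_mem' := by
    rintro g h ⟨a, τ, b, hg⟩ ⟨c, ρ, d, hh⟩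
    refine ⟨a * Units.map (τ : F →* F) c, ρ.trans τ, a * τ d + b, fun x => ?_⟩
    rw [Equiv.Perm.mul_apply, hg, hh]
    simp
    ring
  inv_mem' := by
    rintro g ⟨a, τ, b, hg⟩
    refine ⟨Units.map (τ.symm : F →* F) a⁻¹, τ.symm, - τ.symm (a⁻¹ * b), fun x => ?_⟩
    rw [Equiv.Perm.inv_eq_iff_eq, hg]
    simp [mul_add]

/-- The element `x ↦ a * x` of `GL₁(F) = Fˣ`, as a permutation of `F`. -/
def scalarPerm {F : Type*} [Field F] (a : Fˣ) : Equiv.Perm F :=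
  MulAction.toPerm a

/-- The Frobenius automorphism `σ : x ↦ x ^ p` of `F`, as a permutation of `F`. -/
noncomputable def frobeniusPerm (F : Type*) [Field F] [Finite F] (p : ℕ) [Fact p.Prime]
    [CharP F p] : Equiv.Perm F :=
  (frobeniusEquiv F p).toEquiv

/-! Since `V` is the only minimal normal subgroup and `G/V ≅ H`, being non-basic means that neither
`H` nor `G` has a normal 2-covering.

Suppose this holds. Let `C` be the group of scalars in `H`: its subgroups are all normal in `H`, and
`H/C` embeds in the cyclic group `Aut F`. A non-normal maximal subgroup `M` would cover `H` together
with the centralizer of `C/(C ∩ M)`, so `H` is nilpotent (`isNilpotent_of_not_hasTwoCover`). An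
element of `G` whose linear part has no nonzero fixed vector fixes a point, hence is conjugate into
`H`; so the elements of `H` with nonzero fixed vectors must generate `H`
(`closure_fixed_eq_top_of_not_hasTwoCover`).

For a prime `r` dividing `|H|`, the `r`-part is then `⟨d⟩⟨x⟩`, with `x` fixing a vector, `d` a
scalar and some `d x^i` fixing a vector (`exists_generators`). The last condition makes the norm of
`d` along `⟨x⟩` trivial, whereas irreducibility prevents the subgroup of order `r` in `⟨x⟩` from
centralizing `d`. By `prime_pow_dvd_of_dvd_geom_sum` these are compatible only if `r = 2` and `x` is
an involution, which then inverts `d`. Hence `p ≡ 3 [MOD 4]`, `d` lies in the field of `p²`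
elements, and irreducibility gives `f = 2`.

Conversely, a 2-group `H` has no 2-covering. One of `G` would consist of a complement of `V` and a
subgroup inside a proper normal `M ≥ V`. Elements whose square is a nontrivial translation miss the
complement, so they lie in `M`; but with `V` they generate `G`
(`not_hasTwoCover_of_isPGroup_quotient`). -/

/-! ### Normal coverings by two subgroups -/

/-- `G` is covered by the conjugates of two proper subgroups. -/
def HasTwoCover (G : Type*) [Group G] : Prop :=
  ∃ A B : Subgroup G, A ≠ ⊤ ∧ B ≠ ⊤ ∧ ∀ x, ∃ g, g * x * g⁻¹ ∈ A ∨ g * x * g⁻¹ ∈ B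

/-- Burnside's count: each element fixes a coset of `A`, and by transitivity the average number of
fixed cosets is one. So every element, including the identity, fixes exactly one, and the index is
one. -/
theorem eq_top_of_forall_exists_conj_mem {G : Type*} [Group G] [Finite G] (A : Subgroup G)
    (h : ∀ x, ∃ g, g * x * g⁻¹ ∈ A) : A = ⊤ := by
  classical
  have := Fintype.ofFinite G
  have := Fintype.ofFinite (G ⧸ A)
  have := fun g : G => Fintype.ofFinite (MulAction.fixedBy (G ⧸ A) g)
  have := Fintype.ofFinite (MulAction.orbitRel.Quotient G (G ⧸ A))
  have burnside := MulAction.sum_card_fixedBy_eq_card_orbits_mul_card_group G (G ⧸ A)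
  have horb : Fintype.card (MulAction.orbitRel.Quotient G (G ⧸ A)) = 1 := by
    rw [Fintype.card_eq_one_iff_nonempty_unique]
    exact (MulAction.pretransitive_iff_unique_quotient_of_nonempty G (G ⧸ A)).1 inferInstance
  have hpos : ∀ g : G, 1 ≤ Fintype.card (MulAction.fixedBy (G ⧸ A) g) := by
    intro x
    obtain ⟨g, hg⟩ := h x
    refine Fintype.card_pos_iff.2 ⟨⟨(g⁻¹ : G), ?_⟩⟩
    rw [MulAction.mem_fixedBy]
    change ((x * g⁻¹ : G) : G ⧸ A) = _
    rw [eq_comm, QuotientGroup.eq]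
    simpa [mul_assoc] using hg
  rw [horb, one_mul, ← Finset.card_univ, Finset.card_eq_sum_ones] at burnside
  have h1 := (Finset.sum_eq_sum_iff_of_le (fun g _ => hpos g)).1 burnside.symm 1 (Finset.mem_univ _)
  have h2 : Fintype.card (MulAction.fixedBy (G ⧸ A) (1 : G)) = Fintype.card (G ⧸ A) := by
    refine Fintype.card_congr ⟨Subtype.val, fun y => ⟨y, by simp⟩, fun _ => rfl, fun _ => rfl⟩
  rw [← Subgroup.index_eq_one, Subgroup.index, Nat.card_eq_fintype_card, ← h2, ← h1]

theorem normalCoveringNumber_eq_two_iff {G : Type*} [Group G] [Finite G] :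
    normalCoveringNumber G = 2 ↔ HasTwoCover G := by
  constructor
  · intro h
    have hne : {m : ℕ∞ | ∃ k : ℕ, m = (k : ℕ∞) ∧
        ∃ H : Fin k → Subgroup G, IsNormalCovering H}.Nonempty := by
      by_contra hne
      rw [Set.not_nonempty_iff_eq_empty] at hne
      rw [normalCoveringNumber, hne, sInf_empty] at h
      exact absurd h (by decide)
    have hmem := csInf_mem hne
    change normalCoveringNumber G ∈ _ at hmem
    rw [h] at hmem
    obtain ⟨k, hk, H, hH⟩ := hmem
    obtain rfl : k = 2 := by exact_mod_cast hk.symm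
    refine ⟨H 0, H 1, hH.1 0, hH.1 1, fun x => ?_⟩
    obtain ⟨i, g, hg⟩ := hH.2 x
    exact ⟨g, by fin_cases i <;> [exact .inl hg; exact .inr hg]⟩
  · rintro ⟨A, B, hA, hB, h⟩
    apply le_antisymm
    · refine sInf_le ⟨2, rfl, ![A, B], ?_, fun x => ?_⟩
      · intro i
        fin_cases i <;> simp_all
      · obtain ⟨g, hg | hg⟩ := h x
        · exact ⟨0, g, hg⟩
        · exact ⟨1, g, hg⟩
    · refine le_sInf ?_
      rintro _ ⟨k, rfl, H, hH⟩
      rcases Nat.lt_or_ge k 2 with hk | hk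
      · interval_cases k
        · obtain ⟨i, -⟩ := hH.2 1
          exact i.elim0
        · refine absurd (eq_top_of_forall_exists_conj_mem (H 0) fun x => ?_) (hH.1 0)
          obtain ⟨i, hi⟩ := hH.2 x
          rwa [Subsingleton.elim i 0] at hi
      · exact_mod_cast hk

theorem HasTwoCover.of_surjective {G K : Type*} [Group G] [Group K] (φ : G →* K)
    (hφ : Function.Surjective φ) (h : HasTwoCover K) : HasTwoCover G := by
  obtain ⟨A, B, hA, hB, h⟩ := h
  refine ⟨A.comap φ, B.comap φ, ?_, ?_, fun x => ?_⟩
  · rwa [← Subgroup.comap_top φ, (Subgroup.comap_injective hφ).ne_iff]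
  · rwa [← Subgroup.comap_top φ, (Subgroup.comap_injective hφ).ne_iff]
  · obtain ⟨k, hk⟩ := h (φ x)
    obtain ⟨g, rfl⟩ := hφ k
    exact ⟨g, by simpa using hk⟩

/-! ### Nilpotent groups and p-groups -/

/-- A finite group without normal 2-coverings is nilpotent as soon as it has an abelian normal
subgroup `C` such that all subgroups of `C` and all subgroups above `C` are normal. -/
theorem isNilpotent_of_not_hasTwoCover {H : Type*} [Group H] [Finite H] (C : Subgroup H)
    (hC : ∀ D ≤ C, D.Normal) (hC' : ∀ M, C ≤ M → M.Normal)
    (hcomm : ∀ x ∈ C, ∀ y ∈ C, x * y = y * x) (h : ¬ HasTwoCover H) : Group.IsNilpotent H := by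
  refine ((Group.isNilpotent_of_finite_tfae (G := H)).out 0 2 rfl rfl).2 fun M hM => ?_
  by_contra hMn
  have hCn : C.Normal := hC C le_rfl
  have hsup : C ⊔ M = ⊤ := by
    refine hM.2 _ (lt_of_le_of_ne le_sup_right fun e => hMn (hC' M ?_))
    rw [e]
    exact le_sup_left
  have hDn : (C ⊓ M).Normal := hC _ inf_le_left
  have hmem : ∀ m x, x ∈ C → x * m * x⁻¹ * m⁻¹ ∈ C := fun m x hx => by
    have := C.mul_mem hx (hCn.conj_mem _ (C.inv_mem hx) m)
    simpa [mul_assoc] using this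
  -- `N` is the centralizer of `C/(C ∩ M)`; the covering will be by `M` and `N`.
  let N : Subgroup H := (Subgroup.centralizer
    ((QuotientGroup.mk' (C ⊓ M)) '' (C : Set H))).comap (QuotientGroup.mk' (C ⊓ M))
  have hN : ∀ m, m ∈ N ↔ ∀ x ∈ C, x * m * x⁻¹ * m⁻¹ ∈ C ⊓ M := by
    intro m
    simp only [N, Subgroup.mem_comap, Subgroup.mem_centralizer_iff, Set.forall_mem_image,
      SetLike.mem_coe]
    refine forall₂_congr fun x hx => ?_
    rw [← QuotientGroup.eq_one_iff, ← QuotientGroup.mk'_apply]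
    simp only [map_mul, map_inv]
    rw [mul_inv_eq_one, mul_inv_eq_iff_eq_mul]
  have hCN : C ≤ N := fun c hc => (hN c).2 fun x hx => by
    rw [hcomm x hx c hc]
    simp
  refine h ⟨M, N, hM.1, ?_, ?_⟩
  -- If `N` were everything, commutators of `C` with `M` would lie in `M`, so `H = CM` would
  -- normalize `M`.
  · intro hNt
    refine hMn ⟨fun n hn g => ?_⟩
    obtain ⟨c, hc, m, hm, rfl⟩ := Subgroup.mem_sup_of_normal_left.1 (hsup.ge (Subgroup.mem_top g))
    have h1 := (hN (m * n * m⁻¹)).1 (hNt ▸ Subgroup.mem_top _) c hc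
    convert M.mul_mem h1.2 (M.mul_mem (M.mul_mem hm hn) (M.inv_mem hm)) using 1
    group
  · intro g
    obtain ⟨c, hc, m, hm, rfl⟩ := Subgroup.mem_sup_of_normal_left.1 (hsup.ge (Subgroup.mem_top g))
    by_cases hmN : m ∈ N
    · exact ⟨1, .inr (by simpa using N.mul_mem (hCN hc) hmN)⟩
    -- For `m ∉ N`, the commutator map `x ↦ [x, m]` induces a bijection of `C/(C ∩ M)`. So `c` is
    -- some `[x, m]` modulo `C ∩ M`, and `c m` is conjugate into `M`.
    let ψ : C →* C := MonoidHom.mk' (fun x => ⟨x * m * x⁻¹ * m⁻¹, hmem m x x.2⟩) (by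
      rintro ⟨x, hx⟩ ⟨y, hy⟩
      ext
      have := hcomm x hx _ (hmem m y hy)
      change x * y * m * (x * y)⁻¹ * m⁻¹ = x * m * x⁻¹ * m⁻¹ * (y * m * y⁻¹ * m⁻¹)
      rw [← hcomm _ (hmem m y hy) _ (hmem m x hx)]
      calc x * y * m * (x * y)⁻¹ * m⁻¹ = x * (y * m * y⁻¹ * m⁻¹) * (m * x⁻¹ * m⁻¹) := by group
        _ = _ := by rw [this]; group)
    let φ : C →* C ⧸ (C ⊓ M).subgroupOf C := (QuotientGroup.mk' _).comp ψ
    have hφ : ∀ x : C, x ∈ φ.ker ↔ ((x : H) * m * (x : H)⁻¹ * m⁻¹) ∈ C ⊓ M := fun x => by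
      rw [MonoidHom.mem_ker, MonoidHom.comp_apply, QuotientGroup.mk'_apply,
        QuotientGroup.eq_one_iff, Subgroup.mem_subgroupOf]
      rfl
    have hE : (φ.ker.map C.subtype).Normal := hC _ (Subgroup.map_subtype_le _)
    have hDker : (C ⊓ M).subgroupOf C ≤ φ.ker := fun x hx => by
      rw [hφ]
      have := (C ⊓ M).mul_mem (Subgroup.mem_subgroupOf.1 hx)
        (hDn.conj_mem _ ((C ⊓ M).inv_mem (Subgroup.mem_subgroupOf.1 hx)) m)
      simpa [mul_assoc] using this
    have hker : φ.ker = (C ⊓ M).subgroupOf C := by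
      refine le_antisymm (fun x hx => ?_) hDker
      -- The kernel `E` is normal, so by maximality `EM` is `H` or `M`. In the first case `C = E(C ∩
      -- M) = E`, which puts `m` in `N`.
      rcases hM.le_iff.1 (le_sup_right : M ≤ φ.ker.map C.subtype ⊔ M) with ht | ht
      · refine absurd ((hN m).2 fun y hy => ?_) hmN
        obtain ⟨e, he, μ, hμ, rfl⟩ := Subgroup.mem_sup_of_normal_left.1 (ht.ge (Subgroup.mem_top y))
        obtain ⟨e, he, rfl⟩ := he
        have hμC : μ ∈ C := by simpa using C.mul_mem (C.inv_mem e.2) hy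
        have : (e * ⟨μ, hμC⟩ : C) ∈ φ.ker := φ.ker.mul_mem he (hDker ⟨hμC, hμ⟩)
        exact (hφ _).1 this
      · refine Subgroup.mem_subgroupOf.2 ⟨x.2, ?_⟩
        rw [← ht]
        exact Subgroup.mem_sup_left ⟨x, hx, rfl⟩
    have hsurj : Function.Surjective φ := by
      rw [← MonoidHom.range_eq_top]
      refine Subgroup.eq_top_of_card_eq _ ?_
      rw [← Nat.card_congr (QuotientGroup.quotientKerEquivRange φ).toEquiv, hker]
    obtain ⟨⟨x, hxC⟩, hx⟩ := hsurj (QuotientGroup.mk ⟨c, hc⟩)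
    have hx' : (x * m * x⁻¹ * m⁻¹ : H)⁻¹ * c ∈ C ⊓ M := Subgroup.mem_subgroupOf.1
      (QuotientGroup.eq.1 hx)
    refine ⟨x⁻¹, .inl ?_⟩
    have h1 := (hDn.conj_mem _ ((hDn.conj_mem _ hx' m⁻¹)) (x⁻¹ : H)).2
    have h2 := M.mul_mem hm h1
    convert h2 using 1
    group

theorem IsPGroup.exists_normal_of_ne_top {Q : Type*} [Group Q] [Finite Q] {p : ℕ}
    [Fact p.Prime] (hQ : IsPGroup p Q) {A : Subgroup Q} (hA : A ≠ ⊤) :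
    ∃ M : Subgroup Q, M.Normal ∧ A ≤ M ∧ M ≠ ⊤ := by
  obtain h | ⟨M, hM, hAM⟩ := eq_top_or_exists_le_coatom A
  · exact absurd h hA
  · have := hQ.isNilpotent
    exact ⟨M, ((Group.isNilpotent_of_finite_tfae (G := Q)).out 0 2 rfl rfl).1 this M hM, hAM, hM.1⟩

/-- Inside proper normal subgroups conjugation no longer matters, and a group is not the union of
two proper subgroups. -/
theorem IsPGroup.not_hasTwoCover {Q : Type*} [Group Q] [Finite Q] {p : ℕ}
    [Fact p.Prime] (hQ : IsPGroup p Q) : ¬ HasTwoCover Q := by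
  rintro ⟨A, B, hA, hB, h⟩
  obtain ⟨M, hM, hAM, hM'⟩ := hQ.exists_normal_of_ne_top hA
  obtain ⟨N, hN, hBN, hN'⟩ := hQ.exists_normal_of_ne_top hB
  have key : ∀ x, x ∈ M ∨ x ∈ N := fun x => by
    obtain ⟨g, hg | hg⟩ := h x
    · exact .inl (by simpa [mul_assoc] using hM.conj_mem _ (hAM hg) g⁻¹)
    · exact .inr (by simpa [mul_assoc] using hN.conj_mem _ (hBN hg) g⁻¹)
  obtain ⟨a, ha⟩ : ∃ a, a ∉ M := by
    by_contra! hc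
    exact hM' (M.eq_top_iff'.2 hc)
  obtain ⟨b, hb⟩ : ∃ b, b ∉ N := by
    by_contra! hc
    exact hN' (N.eq_top_iff'.2 hc)
  have haN := (key a).resolve_left ha
  have hbM := (key b).resolve_right hb
  rcases key (a * b) with hab | hab
  · exact ha ((M.mul_mem_cancel_right hbM).1 hab)
  · exact hb ((N.mul_mem_cancel_left haN).1 hab)

/-! ### Coverings and an abelian minimal normal subgroup -/

/-- `A ⊓ N` is normalized by `A` and centralized by the abelian `N`, hence normal in `AN = G`;
minimality makes it trivial. -/
theorem eq_one_of_mem_of_sup_eq_top {G : Type*} [Group G] {N A : Subgroup G}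
    (hmin : IsMinimalNormal N) (hcomm : ∀ x ∈ N, ∀ y ∈ N, x * y = y * x)
    (hA : A ≠ ⊤) (hAN : A ⊔ N = ⊤) {x : G} (hxA : x ∈ A) (hxN : x ∈ N) : x = 1 := by
  have hn : (A ⊓ N).Normal := ⟨fun y hy g => by
    have := hmin.1
    obtain ⟨a, ha, n, hn, rfl⟩ := Subgroup.mem_sup_of_normal_right.1
      (hAN.ge (Subgroup.mem_top g))
    have h1 : a * n * y * (a * n)⁻¹ = a * y * a⁻¹ := by
      rw [mul_assoc a n y, hcomm n hn y hy.2]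
      group
    rw [h1]
    exact ⟨A.mul_mem (A.mul_mem ha hy.1) (A.inv_mem ha), this.conj_mem _ hy.2 _⟩⟩
  by_contra hx
  have h2 := hmin.2.2 _ hn (fun h => hx (by rw [← Subgroup.mem_bot, ← h]; exact ⟨hxA, hxN⟩))
    inf_le_right
  refine hA ?_
  rw [← hAN, eq_comm, sup_eq_left, ← h2]
  exact inf_le_left

theorem not_hasTwoCover_of_isPGroup_quotient {G : Type*} [Group G] [Finite G] {N : Subgroup G}
    [N.Normal] (hmin : IsMinimalNormal N) (hcomm : ∀ x ∈ N, ∀ y ∈ N, x * y = y * x)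
    (hQ : IsPGroup 2 (G ⧸ N))
    (hgen : ∀ M : Subgroup G, N ≤ M → (∀ g, g ^ 2 ∈ N → g ^ 2 ≠ 1 → g ∈ M) → M = ⊤) :
    ¬ HasTwoCover G := by
  have hproper : ∀ A : Subgroup G, A ⊔ N ≠ ⊤ → A.map (QuotientGroup.mk' N) ≠ ⊤ := by
    intro A hA h
    apply hA
    have := congrArg (Subgroup.comap (QuotientGroup.mk' N)) h
    rwa [Subgroup.comap_map_eq, QuotientGroup.ker_mk', Subgroup.comap_top] at this
  have key : ∀ A B : Subgroup G, A ≠ ⊤ → A ⊔ N = ⊤ → B ⊔ N ≠ ⊤ →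
      ¬ ∀ x, ∃ g, g * x * g⁻¹ ∈ A ∨ g * x * g⁻¹ ∈ B := by
    intro A B hA hAN hBN h
    obtain ⟨M, hM, hBM, hM'⟩ := hQ.exists_normal_of_ne_top (hproper B hBN)
    have hNM : N ≤ M.comap (QuotientGroup.mk' N) := by
      intro x hx
      rw [Subgroup.mem_comap, QuotientGroup.mk'_apply, (QuotientGroup.eq_one_iff x).2 hx]
      exact M.one_mem
    refine hM' ?_
    have h1 := hgen _ hNM ?_
    · rwa [← Subgroup.comap_top (QuotientGroup.mk' N),
        (Subgroup.comap_injective (QuotientGroup.mk'_surjective N)).eq_iff] at h1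
    intro g hg hg1
    obtain ⟨k, hk | hk⟩ := h g
    -- A conjugate of `g` in `A` would have its square in `A ⊓ N`, which is trivial.
    · refine absurd ?_ hg1
      have h2 : k * g ^ 2 * k⁻¹ = 1 := by
        refine eq_one_of_mem_of_sup_eq_top hmin hcomm hA hAN ?_ (hmin.1.conj_mem _ hg k)
        rw [← conj_pow]
        exact A.pow_mem hk 2
      exact conj_eq_one_iff.1 h2
    · have h2 := (hM.comap (QuotientGroup.mk' N)).conj_mem _
        (show k * g * k⁻¹ ∈ M.comap (QuotientGroup.mk' N) from hBM ⟨_, hk, rfl⟩) k⁻¹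
      simpa [mul_assoc] using h2
  rintro ⟨A, B, hA, hB, h⟩
  by_cases hAN : A ⊔ N = ⊤ <;> by_cases hBN : B ⊔ N = ⊤
  · obtain ⟨x, hx, hx1⟩ := N.ne_bot_iff_exists_ne_one.1 hmin.2.1 |>.elim fun x hx =>
      (⟨x, x.2, fun h => hx (Subtype.ext h)⟩ : ∃ x : G, x ∈ N ∧ x ≠ 1)
    obtain ⟨k, hk | hk⟩ := h x
    · exact hx1 (conj_eq_one_iff.1
        (eq_one_of_mem_of_sup_eq_top hmin hcomm hA hAN hk (hmin.1.conj_mem _ hx k)))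
    · exact hx1 (conj_eq_one_iff.1
        (eq_one_of_mem_of_sup_eq_top hmin hcomm hB hBN hk (hmin.1.conj_mem _ hx k)))
  · exact key A B hA hAN hBN h
  · exact key B A hB hBN hAN fun x => (h x).imp fun _ => Or.symm
  · refine hQ.not_hasTwoCover ⟨_, _, hproper A hAN, hproper B hBN, fun x => ?_⟩
    obtain ⟨x, rfl⟩ := QuotientGroup.mk'_surjective N x
    obtain ⟨k, hk⟩ := h x
    refine ⟨QuotientGroup.mk' N k, ?_⟩
    rw [← map_mul, ← map_inv, ← map_mul]
    exact hk.imp (fun h => ⟨_, h, rfl⟩) fun h => ⟨_, h, rfl⟩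

/-! ### Tools: nilpotent, dihedral and cyclic groups, field automorphisms, divisibility -/

/-- In a finite nilpotent group, projecting to the Sylow `r`-subgroup is a power map. -/
theorem exists_pow_hom_of_isNilpotent {H : Type*} [Group H] [Finite H] [Group.IsNilpotent H]
    (r : ℕ) [hr : Fact r.Prime] :
    ∃ n : ℕ, (∀ x y : H, (x * y) ^ n = x ^ n * y ^ n) ∧ (∀ x : H, ∃ k, (x ^ n) ^ r ^ k = 1) ∧
      ∀ (x : H) (k : ℕ), x ^ r ^ k = 1 → x ^ n = x := by
  obtain ⟨e⟩ := ((Group.isNilpotent_of_finite_tfae (G := H)).out 0 4 rfl rfl).1 ‹_›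
  obtain ⟨a, m, hm, hcard⟩ := Nat.exists_eq_pow_mul_and_not_dvd
    (Nat.card_pos (α := H)).ne' r hr.1.ne_one
  have hcop : Nat.Coprime (r ^ a) m := ((Nat.Prime.coprime_iff_not_dvd hr.1).2 hm).pow_left a
  -- With `n ≡ 1` modulo the `r`-part of `|H|` and `n ≡ 0` modulo the rest, `x ↦ x ^ n` is the
  -- identity on the Sylow `r`-subgroup and trivial on the others.
  obtain ⟨n, hn1, hn0⟩ := Nat.chineseRemainder hcop 1 0
  have hfix : ∀ (x : H) (k : ℕ), x ^ r ^ k = 1 → x ^ n = x := by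
    intro x k hx
    have h1 : orderOf x ∣ r ^ a := by
      refine Nat.Coprime.dvd_of_dvd_mul_right (n := m) ?_ (hcard ▸ orderOf_dvd_natCard x)
      exact Nat.Coprime.coprime_dvd_left (orderOf_dvd_of_pow_eq_one hx)
        (((Nat.Prime.coprime_iff_not_dvd hr.1).2 hm).pow_left k)
    conv_rhs => rw [← pow_one x]
    exact pow_eq_pow_iff_modEq.2 (hn1.of_dvd h1)
  have hkill : ∀ (x : H) (p : ℕ), p.Prime → p ≠ r → (∃ k, x ^ p ^ k = 1) → x ^ n = 1 := by
    rintro x p hp hpr ⟨k, hx⟩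
    rw [← orderOf_dvd_iff_pow_eq_one]
    refine dvd_trans ?_ (Nat.modEq_zero_iff_dvd.1 hn0)
    refine Nat.Coprime.dvd_of_dvd_mul_left (m := r ^ a) ?_ (hcard ▸ orderOf_dvd_natCard x)
    exact Nat.Coprime.coprime_dvd_left (orderOf_dvd_of_pow_eq_one hx)
      (((Nat.coprime_primes hp hr.1).2 hpr).pow k a)
  have hP : ∀ (p : (Nat.card H).primeFactors) (P : Sylow p H) (x y : P),
      (x * y) ^ n = x ^ n * y ^ n := by
    intro p P x y
    have hpow : ∀ z : P, ∃ k, (z : H) ^ (p : ℕ) ^ k = 1 := fun z => by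
      obtain ⟨k, hk⟩ := P.isPGroup' z
      exact ⟨k, by simpa using congrArg Subtype.val hk⟩
    ext
    push_cast
    by_cases hpr : (p : ℕ) = r
    · have hz : ∀ z : P, (z : H) ^ n = z := fun z => by
        obtain ⟨k, hk⟩ := hpow z
        exact hfix z k (hpr ▸ hk)
      rw [hz x, hz y]
      exact hz (x * y)
    · have hz : ∀ z : P, (z : H) ^ n = 1 := fun z =>
        hkill z p (Nat.prime_of_mem_primeFactors p.2) hpr (hpow z)
      rw [hz x, hz y, one_mul]
      exact hz (x * y)
  refine ⟨n, fun x y => ?_, fun x => ⟨a, ?_⟩, hfix⟩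
  · obtain ⟨x, rfl⟩ := e.surjective x
    obtain ⟨y, rfl⟩ := e.surjective y
    rw [← map_mul, ← map_pow, ← map_pow, ← map_pow, ← map_mul]
    congr 1
    funext p P
    exact hP p P _ _
  · rw [← pow_mul, ← orderOf_dvd_iff_pow_eq_one]
    refine (orderOf_dvd_natCard x).trans ?_
    rw [hcard, mul_comm]
    exact mul_dvd_mul_right (Nat.modEq_zero_iff_dvd.1 hn0) _

theorem isDihedral_of_generators {H : Type*} [Group H] (c x : H) (hc : 0 < orderOf c)
    (hx : x * x = 1) (hxc : x * c * x⁻¹ = c⁻¹) (hxn : x ∉ Subgroup.zpowers c)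
    (hall : ∀ h, h ∈ Subgroup.zpowers c ∨ x * h ∈ Subgroup.zpowers c) : IsDihedral H := by
  set n := orderOf c with hn
  let φ : ZMod n →+ Additive H := ZMod.lift n ⟨zmultiplesHom (Additive H) (Additive.ofMul c), by
    simp [← ofMul_pow, hn, pow_orderOf_eq_one]⟩
  have hφ : ∀ k : ℤ, (φ k).toMul = c ^ k := fun k => by
    simp [φ]
  have hxk : ∀ k : ℤ, c ^ k * x = x * c ^ (-k) := fun k => by
    have h1 : x * c ^ k * x⁻¹ = (c⁻¹) ^ k := by rw [← conj_zpow, hxc]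
    rw [zpow_neg, ← inv_zpow, ← h1, inv_eq_of_mul_eq_one_left hx, ← mul_assoc, ← mul_assoc, hx,
      one_mul]
  let ψ : DihedralGroup n →* H := MonoidHom.mk'
    (fun | .r i => (φ i).toMul | .sr i => x * (φ i).toMul) (by
      rintro (i | i) (j | j) <;> obtain ⟨i, rfl⟩ := ZMod.intCast_surjective i <;>
        obtain ⟨j, rfl⟩ := ZMod.intCast_surjective j
      · simp [DihedralGroup.r_mul_r]
      · rw [DihedralGroup.r_mul_sr]
        simp only [← Int.cast_sub, hφ]
        rw [← mul_assoc, hxk, mul_assoc, ← zpow_add, neg_add_eq_sub]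
      · rw [DihedralGroup.sr_mul_r]
        simp only [← Int.cast_add, hφ]
        rw [mul_assoc, ← zpow_add]
      · rw [DihedralGroup.sr_mul_sr]
        simp only [← Int.cast_sub, hφ]
        rw [mul_assoc, ← mul_assoc (c ^ i), hxk, mul_assoc, ← mul_assoc, hx, one_mul, ← zpow_add,
          neg_add_eq_sub])
  refine ⟨n, hc, ⟨(MulEquiv.ofBijective ψ ⟨?_, ?_⟩).symm⟩⟩
  · rw [injective_iff_map_eq_one]
    rintro (i | i) hi <;> obtain ⟨i, rfl⟩ := ZMod.intCast_surjective i
    · have h1 : c ^ i = 1 := (hφ i).symm.trans hi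
      rw [← orderOf_dvd_iff_zpow_eq_one, ← hn, ← ZMod.intCast_zmod_eq_zero_iff_dvd] at h1
      rw [h1, DihedralGroup.one_def]
    · have h1 : x * c ^ i = 1 := by rw [← hφ]; exact hi
      exact absurd ⟨-i, (zpow_neg c i).trans (eq_inv_of_mul_eq_one_left h1).symm⟩ hxn
  · intro h
    rcases hall h with ⟨k, hk⟩ | ⟨k, hk⟩
    · exact ⟨.r k, (hφ k).trans hk⟩
    · refine ⟨.sr k, ?_⟩
      change x * (φ k).toMul = h
      rw [hφ, show c ^ k = x * h from hk, ← mul_assoc, hx, one_mul]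

/-- In a cyclic group `x ^ n = 1` has at most `n` solutions; for `n = orderOf a` the powers of `a`
are already that many. -/
theorem mem_zpowers_of_orderOf_dvd_orderOf {A : Type*} [Group A] [Finite A] [IsCyclic A] {a b : A}
    (h : orderOf b ∣ orderOf a) : b ∈ Subgroup.zpowers a := by
  classical
  have := Fintype.ofFinite A
  have h1 : (Subgroup.zpowers a : Set A).toFinset ⊆
      Finset.univ.filter fun x : A => x ^ orderOf a = 1 := by
    intro x hx
    obtain ⟨k, rfl⟩ := Set.mem_toFinset.1 hx
    simp only [Finset.mem_filter, Finset.mem_univ, true_and]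
    rw [← zpow_natCast, zpow_comm, zpow_natCast, pow_orderOf_eq_one, one_zpow]
  have h2 := Finset.eq_of_subset_of_card_le h1 (by
    refine (IsCyclic.card_pow_eq_one_le (orderOf_pos a)).trans ?_
    rw [Set.toFinset_card, ← Nat.card_eq_fintype_card]
    exact (Nat.card_zpowers a).ge)
  have h3 : b ∈ (Subgroup.zpowers a : Set A).toFinset := by
    rw [h2]
    simpa using orderOf_dvd_iff_pow_eq_one.1 h
  exact Set.mem_toFinset.1 h3

theorem exists_forall_ringEquiv_eq_pow {F : Type*} [Field F] [Finite F] (p : ℕ) [Fact p.Prime]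
    [CharP F p] (τ : F ≃+* F) : ∃ l : ℕ, ∀ x, τ x = x ^ p ^ l := by
  have := Fintype.ofFinite F
  let _ : Algebra (ZMod p) F := ZMod.algebra F p
  let τ' : F ≃ₐ[ZMod p] F := AlgEquiv.ofRingEquiv (f := τ) fun x => by
    exact RingHom.congr_fun (Subsingleton.elim
      ((τ : F →+* F).comp (algebraMap (ZMod p) F)) (algebraMap (ZMod p) F)) x
  obtain ⟨n, hn⟩ := (FiniteField.bijective_frobeniusAlgEquivOfAlgebraic_pow (ZMod p) F).2 τ'
  refine ⟨n, fun x => ?_⟩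
  have := DFunLike.congr_fun hn x
  simp only [AlgEquiv.coe_pow, FiniteField.coe_frobeniusAlgEquivOfAlgebraic_iterate,
    ZMod.card] at this
  exact this.symm

theorem isCyclic_ringEquiv (F : Type*) [Field F] [Finite F] : IsCyclic (F ≃+* F) := by
  obtain ⟨p, hp⟩ := CharP.exists F
  have := Fact.mk (CharP.char_is_prime F p)
  refine ⟨frobeniusEquiv F p, fun τ => ?_⟩
  obtain ⟨l, hl⟩ := exists_forall_ringEquiv_eq_pow p τ
  refine ⟨l, ?_⟩
  have key : ∀ (n : ℕ) (x : F), (frobeniusEquiv F p ^ n : F ≃+* F) x = x ^ p ^ n := by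
    intro n
    induction n with
    | zero => simp
    | succ n ih =>
      intro x
      rw [pow_succ', RingAut.mul_apply, ih, frobeniusEquiv_def, ← pow_mul, pow_succ]
  ext x
  rw [hl, ← key]
  simp

/-- Let `r` be prime and `k ≡ 1` modulo `r`. A power of `r` dividing `1 + k + ⋯ + k ^ (r ^ (s + 1) - 1)`
also divides `k ^ r ^ s - 1`, except possibly when `r = 2` and `s = 0`. -/
theorem prime_pow_dvd_of_dvd_geom_sum {r : ℕ} (hr : r.Prime) {s m : ℕ} {k : ℤ}
    (hk : (r : ℤ) ∣ k - 1) (hrs : r ≠ 2 ∨ s ≠ 0)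
    (hdvd : (r : ℤ) ^ m ∣ ∑ i ∈ Finset.range (r ^ (s + 1)), k ^ i) :
    (r : ℤ) ^ m ∣ k ^ r ^ s - 1 := by
  by_cases hk1 : k = 1
  · simp [hk1]
  set K := k ^ r ^ s with hK
  set A := ∑ i ∈ Finset.range (r ^ s), k ^ i
  set B := ∑ i ∈ Finset.range r, K ^ i
  have hA : A * (k - 1) = K - 1 := geom_sum_mul k _
  have hB : B * (K - 1) = K ^ r - 1 := geom_sum_mul K _
  have hAB : ∑ i ∈ Finset.range (r ^ (s + 1)), k ^ i = A * B := by
    have h1 := geom_sum_mul k (r ^ (s + 1))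
    refine mul_right_cancel₀ (sub_ne_zero.2 hk1) ?_
    rw [h1, mul_right_comm, hA, mul_comm, hB, hK, ← pow_mul, pow_succ]
  have hrK : (r : ℤ) ∣ K - 1 := hA ▸ hk.mul_left A
  -- `B` contains `r` exactly once, and the factor `k - 1` of `K - 1 = A (k - 1)` makes up for it.
  -- For `r = 2` this needs `K` to be an odd square, whence `s ≠ 0`.
  have hBr : (r : ℤ) ^ 2 ∣ B - r := by
    rcases hr.eq_two_or_odd' with rfl | hodd
    · obtain ⟨s, rfl⟩ : ∃ s', s = s' + 1 := Nat.exists_eq_succ_of_ne_zero (by simpa using hrs)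
      have hB2 : B = 1 + K := by simp [B, Finset.sum_range_succ]
      have h1 : (2 : ℤ) ∣ k ^ 2 ^ s - 1 := by
        have := sub_one_dvd_pow_sub_one k (2 ^ s)
        exact hk.trans this
      rw [hB2, hK, pow_succ 2 s, pow_mul]
      obtain ⟨l, hl⟩ := h1
      exact ⟨l * (l + 1), by push_cast; rw [eq_add_of_sub_eq hl]; ring⟩
    · obtain ⟨l, hl⟩ := hrK
      have := odd_sq_dvd_geom_sum₂_sub (R := ℤ) (a := 1) (b := l) hodd
      simpa [B, eq_add_of_sub_eq hl, add_comm] using this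
  obtain ⟨w, hw⟩ := hBr
  have hBu : B = r * (1 + r * w) := by linear_combination hw
  have hcop : IsCoprime ((r : ℤ) ^ m) (1 + r * w) := by
    refine IsCoprime.pow_left ⟨-w, 1, by ring⟩
  rw [hAB, hBu, ← mul_assoc] at hdvd
  have h1 := hcop.dvd_of_dvd_mul_right hdvd
  rw [← hA]
  exact h1.trans (mul_dvd_mul_left A hk)

/-! ### Groups of semilinear maps -/

/-- `h • x = a h * θ h x`: the group `H` acts on `F` by semilinear maps. -/
structure IsSemilinearAction {H F : Type*} [Group H] [Field F] [MulAction H F] (a : H → F)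
    (θ : H →* (F ≃+* F)) : Prop where
  ne_zero : ∀ h, a h ≠ 0
  smul : ∀ h x, h • x = a h * θ h x

namespace IsSemilinearAction

variable {H F : Type*} [Group H] [Field F] [MulAction H F] {a : H → F} {θ : H →* (F ≃+* F)}

theorem smul_one (ha : IsSemilinearAction a θ) (h : H) : h • (1 : F) = a h := by
  rw [ha.smul, map_one, mul_one]

theorem smul_of_eq_one (ha : IsSemilinearAction a θ) {d : H} (hd : θ d = 1) (x : F) :
    d • x = a d * x := by
  rw [ha.smul, hd]
  rfl

theorem coeff_pow (ha : IsSemilinearAction a θ) {d : H} (hd : θ d = 1) (k : ℕ) :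
    a (d ^ k) = a d ^ k := by
  induction k with
  | zero => rw [pow_zero, pow_zero, ← ha.smul_one, one_smul]
  | succ k ih => rw [pow_succ', pow_succ', ← ha.smul_one, mul_smul, ha.smul_one, ih,
      ha.smul_of_eq_one hd]

theorem smul_add (ha : IsSemilinearAction a θ) (h : H) (x y : F) :
    h • (x + y) = h • x + h • y := by
  simp only [ha.smul, map_add, mul_add]

theorem smul_zero (ha : IsSemilinearAction a θ) (h : H) : h • (0 : F) = 0 := by
  rw [ha.smul, map_zero, mul_zero]

theorem smul_neg (ha : IsSemilinearAction a θ) (h : H) (x : F) : h • (-x) = -(h • x) := by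
  simp only [ha.smul, map_neg, mul_neg]

theorem conj_eq_pow [FaithfulSMul H F] (ha : IsSemilinearAction a θ) {d g : H} (hd : θ d = 1)
    {k : ℕ} (hg : ∀ x, θ g x = x ^ k) : g * d * g⁻¹ = d ^ k := by
  rw [mul_inv_eq_iff_eq_mul]
  refine FaithfulSMul.eq_of_smul_eq_smul (α := F) fun x => ?_
  have hdk : θ (d ^ k) = 1 := by rw [map_pow, hd, one_pow]
  rw [mul_smul, mul_smul, ha.smul_of_eq_one hd, ha.smul_of_eq_one hdk, ha.coeff_pow hd,
    ha.smul g, ha.smul g, map_mul, hg (a d)]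
  ring

theorem eq_one_of_fixed [FaithfulSMul H F] (ha : IsSemilinearAction a θ) {d : H} (hd : θ d = 1)
    {v : F} (hv : v ≠ 0) (h : d • v = v) : d = 1 := by
  rw [ha.smul_of_eq_one hd] at h
  have h1 : a d = 1 := mul_right_cancel₀ hv (h.trans (one_mul v).symm)
  refine FaithfulSMul.eq_of_smul_eq_smul (α := F) fun x => ?_
  rw [ha.smul_of_eq_one hd, h1, one_mul, one_smul]

/-- The homomorphism from the scalars in `H` to `Fˣ`. -/
def scalarHom (ha : IsSemilinearAction a θ) : θ.ker →* Fˣ :=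
  MonoidHom.mk' (fun d => Units.mk0 (a d) (ha.ne_zero d)) fun d e => by
    ext
    change a (d * e) = a d * a e
    rw [← ha.smul_one, mul_smul, ha.smul_one, ha.smul_of_eq_one d.2]

theorem scalarHom_injective [FaithfulSMul H F] (ha : IsSemilinearAction a θ) :
    Function.Injective ha.scalarHom := by
  rw [injective_iff_map_eq_one]
  intro d hd
  refine Subtype.ext (ha.eq_one_of_fixed d.2 one_ne_zero ?_)
  rw [ha.smul_one]
  exact congrArg Units.val hd

/-- A nontrivial central element of an irreducible group has no nonzero fixed vector. -/
theorem eq_one_of_central [FaithfulSMul H F] (ha : IsSemilinearAction a θ)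
    (hirr : ∀ W : AddSubgroup F, (∀ (h : H), ∀ w ∈ W, h • w ∈ W) → W = ⊥ ∨ W = ⊤) {y : H}
    (hy : ∀ h, y * h = h * y) {v : F} (hv : v ≠ 0) (hyv : y • v = v) : y = 1 := by
  let W : AddSubgroup F :=
    { carrier := {w | y • w = w}
      zero_mem' := ha.smul_zero y
      add_mem' := fun {u w} hu hw => by
        change y • (u + w) = u + w
        rw [ha.smul_add, hu, hw]
      neg_mem' := fun {u} hu => by
        change y • (-u) = -u
        rw [ha.smul_neg, hu] }
  have hW : ∀ w, w ∈ W ↔ y • w = w := fun _ => Iff.rfl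
  rcases hirr W fun h w hw => by rw [hW, ← mul_smul, hy, mul_smul, (hW w).1 hw] with h | h
  · refine absurd ?_ hv
    rw [← AddSubgroup.mem_bot, ← h, hW, hyv]
  · refine FaithfulSMul.eq_of_smul_eq_smul (α := F) fun x => ?_
    rw [one_smul, ← hW, h]
    trivial

/-- The criterion applies to the scalars `θ.ker`: conjugation acts on them by power maps, they embed
in `Fˣ`, and the quotient embeds in the abelian group `Aut F`. -/
theorem isNilpotent [FaithfulSMul H F] [Finite F] [Finite H] (ha : IsSemilinearAction a θ)
    (h : ¬ HasTwoCover H) : Group.IsNilpotent H := by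
  have := isCyclic_ringEquiv F
  obtain ⟨p, hp⟩ := CharP.exists F
  have := Fact.mk (CharP.char_is_prime F p)
  refine isNilpotent_of_not_hasTwoCover θ.ker (fun D hD => ⟨fun d hd g => ?_⟩)
    (fun M hM => ⟨fun m hm g => ?_⟩) (fun x hx y hy => ?_) h
  · obtain ⟨l, hl⟩ := exists_forall_ringEquiv_eq_pow p (θ g)
    rw [ha.conj_eq_pow (hD hd) hl]
    exact D.pow_mem hd _
  · rw [← M.mul_mem_cancel_right (M.inv_mem hm)]
    refine hM ?_
    rw [MonoidHom.mem_ker]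
    have := (IsCyclic.commGroup (α := F ≃+* F)).mul_comm
    simp only [map_mul, map_inv]
    rw [this (θ g) (θ m)]
    group
  · have : ha.scalarHom (⟨x, hx⟩ * ⟨y, hy⟩) = ha.scalarHom (⟨y, hy⟩ * ⟨x, hx⟩) := by
      rw [map_mul, map_mul, mul_comm]
    exact congrArg Subtype.val (ha.scalarHom_injective this)

end IsSemilinearAction

/-- The analogue of the easy half of Hilbert 90, for an automorphism `τ : x ↦ x ^ k` with
`τ ^ n = 1`: the norm of an element `u / (τ ^ i) u` is `1`. -/
theorem pow_geom_sum_eq_one_of_mul_eq {F : Type*} [Field F] {τ : F ≃+* F} {k n i : ℕ}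
    (hk : ∀ x, τ x = x ^ k) (hn : τ ^ n = 1) {δ u : F} (hu : u ≠ 0) (h : δ * (τ ^ i) u = u) :
    δ ^ ∑ j ∈ Finset.range n, k ^ j = 1 := by
  have hpow : ∀ (j : ℕ) (x : F), (τ ^ j) x = x ^ k ^ j := by
    intro j
    induction j with
    | zero => simp
    | succ j ih =>
      intro x
      rw [pow_succ', RingAut.mul_apply, ih, hk, ← pow_mul, pow_succ]
  set S := ∑ j ∈ Finset.range n, k ^ j with hS
  have hSk : k * S + 1 = S + k ^ n := by
    rw [hS, Finset.mul_sum, ← Finset.sum_range_succ, Finset.sum_range_succ']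
    simp [pow_succ']
  -- The exponent `S` is the norm, so it does not distinguish `w` from `τ w`; `hSk` is the
  -- telescoping behind this.
  have hN1 : ∀ w : F, w ≠ 0 → (τ w) ^ S = w ^ S := fun w hw => by
    have h1 : w ^ k ^ n = w := by rw [← hpow, hn, RingAut.one_apply]
    refine mul_right_cancel₀ hw ?_
    rw [hk, ← pow_mul, ← pow_succ, hSk, pow_add, h1]
  have hN : ∀ j : ℕ, ((τ ^ j) u) ^ S = u ^ S := by
    intro j
    induction j with
    | zero => simp
    | succ j ih =>
      rw [pow_succ', RingAut.mul_apply, hN1 _ ((map_ne_zero_iff _ (τ ^ j).injective).2 hu), ih]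
  have h1 := congrArg (· ^ S) h
  simp only [mul_pow, hN] at h1
  exact mul_right_cancel₀ (pow_ne_zero S hu) (h1.trans (one_mul _).symm)

/-! ### The prime parts of an irreducible nilpotent group -/

namespace IsSemilinearAction

variable {H F : Type*} [Group H] [Field F] [MulAction H F] {a : H → F} {θ : H →* (F ≃+* F)}

/-- Taking a fixed vector `v` as the unit turns `x` into a pure field automorphism. -/
theorem smul_pow_of_fixed (ha : IsSemilinearAction a θ) {x : H} {v : F} (hv : v ≠ 0)
    (hx : x • v = v) (i : ℕ) (w : F) : x ^ i • w = v * (θ x ^ i) (w / v) := by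
  have hxi : x ^ i • v = v := by
    induction i with
    | zero => simp
    | succ i ih => rw [pow_succ, mul_smul, hx, ih]
  have h1 := ha.smul (x ^ i) v
  rw [hxi] at h1
  rw [ha.smul, map_div₀, ← map_pow]
  have : θ (x ^ i) v ≠ 0 := (map_ne_zero_iff _ (θ (x ^ i)).injective).2 hv
  rw [← mul_div_assoc, eq_div_iff this]
  linear_combination (-(θ (x ^ i) w)) * h1

/-- The `r`-part of an irreducible nilpotent group of semilinear maps generated by elements with
nonzero fixed vectors. -/
theorem exists_generators [FaithfulSMul H F] [Finite F] [Finite H] [Group.IsNilpotent H]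
    (ha : IsSemilinearAction a θ)
    (hirr : ∀ W : AddSubgroup F, (∀ (h : H), ∀ w ∈ W, h • w ∈ W) → W = ⊥ ∨ W = ⊤)
    (hfix : Subgroup.closure {h : H | ∃ v : F, v ≠ 0 ∧ h • v = v} = ⊤)
    {r : ℕ} (hr : r.Prime) (hrH : r ∣ Nat.card H) :
    r = 2 ∧ ∃ (x d : H) (v : F), v ≠ 0 ∧ x • v = v ∧ x ≠ 1 ∧ x ^ 2 = 1 ∧ θ d = 1 ∧
      (∃ m, orderOf d = 2 ^ m) ∧ x * d * x⁻¹ = d⁻¹ ∧ d ^ 2 ≠ 1 ∧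
      ∀ h : H, (∃ k, h ^ r ^ k = 1) → ∃ i j : ℕ, h = d ^ i * x ^ j := by
  have := Fact.mk hr
  have hcyc := isCyclic_ringEquiv F
  obtain ⟨p, hp⟩ := CharP.exists F
  have := Fact.mk (CharP.char_is_prime F p)
  have : Finite (F ≃+* F) := Finite.of_injective (fun e => (e : F → F)) DFunLike.coe_injective
  obtain ⟨n, hmul, hpow, hid⟩ := exists_pow_hom_of_isNilpotent (H := H) r
  let π : H →* H := MonoidHom.mk' (· ^ n) hmul
  have hπ : ∀ h, π h = h ^ n := fun _ => rfl
  have hmemP : ∀ h, h ∈ π.range ↔ ∃ k, h ^ r ^ k = 1 := fun h =>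
    ⟨fun ⟨g, hg⟩ => hg ▸ hpow g, fun ⟨k, hk⟩ => ⟨h, hid h k hk⟩⟩
  have hπP : ∀ h ∈ π.range, π h = h := fun h hh => by
    obtain ⟨k, hk⟩ := (hmemP h).1 hh
    exact hid h k hk
  have hordP : ∀ h ∈ π.range, ∃ k, orderOf h = r ^ k := fun h hh => by
    obtain ⟨k, hk⟩ := (hmemP h).1 hh
    obtain ⟨j, -, hj⟩ := (Nat.dvd_prime_pow hr).1 (orderOf_dvd_of_pow_eq_one hk)
    exact ⟨j, hj⟩
  have hPn : π.range.Normal := ⟨fun h ⟨g, hg⟩ y => ⟨y * g * y⁻¹, by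
    rw [← hg, hπ, hπ, conj_pow]⟩⟩
  -- central elements of the `r`-part are central
  have hcentral : ∀ y ∈ π.range, (∀ h ∈ π.range, y * h = h * y) → ∀ h, y * h = h * y := by
    intro y hy hyP h
    -- The commutator lies in the normal `r`-part, so `π` fixes it; but `π` sends it to the
    -- commutator of `y` and `π h`, which is trivial.
    have h1 : y * h * y⁻¹ * h⁻¹ ∈ π.range := by
      have := mul_mem hy (hPn.conj_mem _ (inv_mem hy) h)
      simpa [mul_assoc] using this
    rw [← mul_inv_eq_iff_eq_mul, ← mul_inv_eq_one, ← hπP _ h1]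
    simp only [map_mul, map_inv]
    rw [hπP y hy, hyP (π h) ⟨h, rfl⟩]
    group
  -- the `r`-part is generated by a set `S` of elements with fixed vectors
  set S : Set H := π '' {h : H | ∃ v : F, v ≠ 0 ∧ h • v = v} with hS
  have hSP : Subgroup.closure S = π.range := by
    rw [hS, ← MonoidHom.map_closure, hfix, MonoidHom.range_eq_map]
  have hSsub : ∀ s ∈ S, s ∈ π.range := fun s hs => hSP ▸ Subgroup.subset_closure hs
  have hSfix : ∀ s ∈ S, ∃ v : F, v ≠ 0 ∧ s • v = v := by
    rintro _ ⟨h, ⟨v, hv, hhv⟩, rfl⟩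
    refine ⟨v, hv, ?_⟩
    rw [hπ]
    exact (MulAction.stabilizer H v).pow_mem hhv n
  -- an element of `S` whose image generates the image of the `r`-part
  obtain ⟨x, hxS, hxmax⟩ : ∃ x ∈ S, ∀ s ∈ S, orderOf (θ s) ≤ orderOf (θ x) :=
    Set.exists_max_image S (fun s => orderOf (θ s)) (Set.toFinite S)
      ⟨1, 1, ⟨1, one_ne_zero, one_smul _ _⟩, map_one π⟩
  have hxP := hSsub x hxS
  obtain ⟨v, hv, hxv⟩ := hSfix x hxS
  have hθ : ∀ h ∈ π.range, θ h ∈ Subgroup.zpowers (θ x) := by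
    have : π.range ≤ (Subgroup.zpowers (θ x)).comap θ := by
      rw [← hSP, Subgroup.closure_le]
      intro s hs
      refine mem_zpowers_of_orderOf_dvd_orderOf ?_
      have hθr : ∀ s ∈ S, ∃ k, orderOf (θ s) = r ^ k := fun s hs => by
        obtain ⟨k, hk⟩ := hordP s (hSsub s hs)
        obtain ⟨j, -, hj⟩ := (Nat.dvd_prime_pow hr).1 (hk ▸ orderOf_map_dvd θ s)
        exact ⟨j, hj⟩
      obtain ⟨k, hk⟩ := hθr s hs
      obtain ⟨l, hl⟩ := hθr x hxS
      have := hxmax s hs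
      rw [hk, hl] at this ⊢
      exact pow_dvd_pow r ((Nat.pow_le_pow_iff_right hr.one_lt).1 this)
    exact this
  set C : Subgroup H := π.range ⊓ θ.ker with hC
  have hdecomp : ∀ h ∈ π.range, ∃ c ∈ C, ∃ i : ℕ, h = c * x ^ i := by
    intro h hh
    obtain ⟨i, hi⟩ := mem_powers_iff_mem_zpowers.2 (hθ h hh)
    refine ⟨h * (x ^ i)⁻¹,
      Subgroup.mem_inf.2 ⟨mul_mem hh (inv_mem (pow_mem hxP i)), ?_⟩, i, by group⟩
    rw [MonoidHom.mem_ker, map_mul, map_inv, map_pow, mul_inv_eq_one]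
    exact hi.symm
  have hxker : ∀ i : ℕ, θ (x ^ i) = 1 → x ^ i = 1 := fun i hi =>
    ha.eq_one_of_fixed hi hv ((MulAction.stabilizer H v).pow_mem hxv i)
  have hx1 : x ≠ 1 := by
    intro hx1
    obtain ⟨y, hy⟩ := exists_prime_orderOf_dvd_card' r hrH
    have hyP : y ∈ π.range := (hmemP y).2 ⟨1, by rw [pow_one, ← hy, pow_orderOf_eq_one]⟩
    have : π.range ≤ ⊥ := by
      rw [← hSP, Subgroup.closure_le]
      intro s hs
      obtain ⟨w, hw, hsw⟩ := hSfix s hs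
      refine Subgroup.mem_bot.2 (ha.eq_one_of_fixed ?_ hw hsw)
      simpa [hx1] using hθ s (hSsub s hs)
    rw [Subgroup.mem_bot.1 (this hyP), orderOf_one] at hy
    exact hr.one_lt.ne hy
  obtain ⟨t, ht⟩ := hordP x hxP
  obtain ⟨s, rfl⟩ : ∃ s, t = s + 1 := by
    refine Nat.exists_eq_succ_of_ne_zero ?_
    rintro rfl
    exact hx1 (orderOf_eq_one_iff.1 (by simpa using ht))
  set y := x ^ r ^ s with hy
  have hy1 : y ≠ 1 := by
    intro h
    have := orderOf_dvd_of_pow_eq_one h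
    rw [ht, Nat.pow_dvd_pow_iff_le_right hr.one_lt] at this
    omega
  have hyP : y ∈ π.range := pow_mem hxP _
  -- `y` has order `r` and fixes `v`, so it is not central. It commutes with `x`, hence must fail to
  -- commute with a scalar.
  obtain ⟨c₀, hc₀, hc₀y⟩ : ∃ c ∈ C, y * c ≠ c * y := by
    by_contra! hc
    refine hy1 (ha.eq_one_of_central hirr (hcentral y hyP fun h hh => ?_) hv
      ((MulAction.stabilizer H v).pow_mem hxv _))
    obtain ⟨c, hcC, i, rfl⟩ := hdecomp h hh
    rw [← mul_assoc, hc c hcC, mul_assoc, mul_assoc, hy, ← pow_add, ← pow_add, add_comm]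
  have : IsCyclic C := isCyclic_of_injective
    (ha.scalarHom.comp (Subgroup.inclusion (inf_le_right : C ≤ θ.ker)))
    (ha.scalarHom_injective.comp (Subgroup.inclusion_injective _))
  obtain ⟨⟨c, hcC⟩, hc⟩ := IsCyclic.exists_generator (α := C)
  have hcgen : ∀ d ∈ C, d ∈ Subgroup.zpowers c := fun d hd => by
    obtain ⟨k, hk⟩ := hc ⟨d, hd⟩
    exact ⟨k, congrArg Subtype.val hk⟩
  have hcomm_of_mem : ∀ d, c ∈ Subgroup.zpowers d → y * d ≠ d * y := by
    intro d hcd h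
    obtain ⟨k, rfl⟩ := Subgroup.mem_zpowers_iff.1 hcd
    obtain ⟨j, rfl⟩ := Subgroup.mem_zpowers_iff.1 (hcgen c₀ hc₀)
    exact hc₀y (Commute.zpow_right (Commute.zpow_right h k) j)
  have hconj : ∀ d ∈ C, ∀ g : H, ∃ k : ℕ, g * d * g⁻¹ = d ^ k := fun d hd g => by
    obtain ⟨l, hl⟩ := exists_forall_ringEquiv_eq_pow p (θ g)
    exact ⟨_, ha.conj_eq_pow hd.2 hl⟩
  -- an element of `S` whose scalar part generates `C`
  obtain ⟨d, hdC, hcd, i, hzS⟩ : ∃ d ∈ C, c ∈ Subgroup.zpowers d ∧ ∃ i : ℕ, d * x ^ i ∈ S := by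
    obtain ⟨k, hk⟩ := hordP c hcC.1
    have hcrC : c ^ r ∈ C := pow_mem hcC r
    have hTn : (Subgroup.zpowers (c ^ r)).Normal := ⟨fun h hh g => by
      obtain ⟨j, rfl⟩ := Subgroup.mem_zpowers_iff.1 hh
      obtain ⟨l, hl⟩ := hconj _ (zpow_mem hcrC j) g
      rw [hl]
      exact pow_mem hh l⟩
    have hnot : c ∉ Subgroup.zpowers (c ^ r) := by
      intro h
      obtain ⟨j, hj⟩ := Subgroup.mem_zpowers_iff.1 h
      have h1 : c ^ ((r : ℤ) * j - 1) = 1 := by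
        rw [zpow_sub, zpow_mul, zpow_natCast, hj, zpow_one, mul_inv_cancel]
      have h2 := orderOf_dvd_iff_zpow_eq_one.2 h1
      have hk0 : k = 0 := by
        by_contra hk0
        have h3 : (r : ℤ) ∣ r * j - 1 :=
          dvd_trans (by rw [hk]; exact_mod_cast dvd_pow_self r hk0) h2
        have h4 : (r : ℤ) ∣ 1 := by
          have := dvd_sub (dvd_mul_right (r : ℤ) j) h3
          simpa using this
        exact hr.one_lt.ne' (by exact_mod_cast Int.eq_one_of_dvd_one (by positivity) h4)
      rw [hk0, pow_zero, orderOf_eq_one_iff] at hk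
      refine hcomm_of_mem 1 ?_ (by simp)
      rw [hk]
      exact Subgroup.mem_zpowers 1
    -- `⟨c ^ r⟩⟨x⟩` is a proper subgroup of the `r`-part, so some element of `S` lies outside; its
    -- scalar part is a power of `c` with exponent prime to `r`.
    have hcT : c ∉ Subgroup.zpowers (c ^ r) ⊔ Subgroup.zpowers x := by
      intro h
      obtain ⟨d, hd, g, hg, hdg⟩ := Subgroup.mem_sup_of_normal_left.1 h
      obtain ⟨i, rfl⟩ := mem_powers_iff_mem_zpowers.2 hg
      have hdC : d ∈ C := (Subgroup.zpowers_le.2 hcrC) hd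
      have h1 : x ^ i = 1 := hxker i (by
        have := congrArg θ hdg
        rwa [map_mul, (hdC.2 : θ d = 1), (hcC.2 : θ c = 1), one_mul] at this)
      change d * x ^ i = c at hdg
      rw [h1, mul_one] at hdg
      exact hnot (hdg ▸ hd)
    obtain ⟨z, hzS, hzT⟩ : ∃ z ∈ S, z ∉ Subgroup.zpowers (c ^ r) ⊔ Subgroup.zpowers x := by
      by_contra! hall
      refine hcT ?_
      have : π.range ≤ Subgroup.zpowers (c ^ r) ⊔ Subgroup.zpowers x := by
        rw [← hSP, Subgroup.closure_le]
        exact hall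
      exact this hcC.1
    obtain ⟨d, hdC, i, rfl⟩ := hdecomp z (hSsub z hzS)
    refine ⟨d, hdC, ?_, i, hzS⟩
    obtain ⟨j, rfl⟩ := mem_powers_iff_mem_zpowers.2 (hcgen d hdC)
    have hrj : ¬ r ∣ j := by
      rintro ⟨l, rfl⟩
      refine hzT (Subgroup.mul_mem_sup ⟨l, ?_⟩ (pow_mem (Subgroup.mem_zpowers x) i))
      simp [pow_mul]
    change c ∈ Subgroup.zpowers (c ^ j)
    have hcop : Nat.Coprime (orderOf c) j := by
      rw [hk]
      exact ((Nat.Prime.coprime_iff_not_dvd hr).2 hrj).pow_left k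
    obtain ⟨l, hl⟩ := exists_pow_eq_self_of_coprime hcop.symm
    exact ⟨l, by simpa using hl⟩
  have hdy := hcomm_of_mem d hcd
  obtain ⟨m, hm⟩ := hordP d hdC.1
  have hdgen : ∀ e ∈ C, e ∈ Subgroup.zpowers d := fun e he =>
    (Subgroup.zpowers_le.2 hcd) (hcgen e he)
  obtain ⟨l, hl⟩ := exists_forall_ringEquiv_eq_pow p (θ x)
  set k := p ^ l with hk
  have hpowθ : ∀ (j : ℕ) (u : F), θ (x ^ j) u = u ^ k ^ j := by
    intro j
    induction j with
    | zero => simp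
    | succ j ih =>
      intro u
      rw [pow_succ', map_mul, RingAut.mul_apply, ih, hl, ← pow_mul, pow_succ]
  have hconjx : ∀ j : ℕ, x ^ j * d * (x ^ j)⁻¹ = d ^ k ^ j := fun j =>
    ha.conj_eq_pow hdC.2 (hpowθ j)
  -- In the coordinate `w / v` the fixed vector of `d x^i` gives `δ · τ^i(u) = u`, so `δ` has norm
  -- one.
  have hnorm : d ^ ∑ j ∈ Finset.range (r ^ (s + 1)), k ^ j = 1 := by
    obtain ⟨w, hw, hzw⟩ := hSfix _ hzS
    rw [mul_smul, ha.smul_pow_of_fixed hv hxv, ha.smul_of_eq_one hdC.2] at hzw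
    refine ha.eq_one_of_fixed (v := 1) (by rw [map_pow, (hdC.2 : θ d = 1), one_pow]) one_ne_zero ?_
    rw [ha.smul_one, ha.coeff_pow hdC.2]
    refine pow_geom_sum_eq_one_of_mul_eq (u := w / v) (i := i) hl ?_ (div_ne_zero hw hv) ?_
    · rw [← map_pow, ← ht, pow_orderOf_eq_one, map_one]
    · rw [eq_div_iff hv]
      linear_combination hzw
  have hm0 : m ≠ 0 := by
    rintro rfl
    rw [pow_zero, orderOf_eq_one_iff] at hm
    exact hdy (by simp [hm])
  have hdvd_of : ∀ j : ℕ, x ^ j * d * (x ^ j)⁻¹ = d → (r : ℤ) ^ m ∣ (k : ℤ) ^ j - 1 := by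
    intro j hj
    rw [hconjx] at hj
    have : d ^ ((k : ℤ) ^ j - 1) = 1 := by
      rw [zpow_sub, zpow_one, ← Nat.cast_pow, zpow_natCast, hj, mul_inv_cancel]
    have := orderOf_dvd_iff_zpow_eq_one.2 this
    rw [hm] at this
    exact_mod_cast this
  -- `x` has order `r ^ (s + 1)`, so `k ^ r ^ (s + 1) ≡ 1` modulo `r`, and Fermat's little theorem
  -- removes the exponent.
  have hk1 : (r : ℤ) ∣ (k : ℤ) - 1 := by
    have h1 : (r : ℤ) ∣ (k : ℤ) ^ r ^ (s + 1) - 1 :=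
      (dvd_pow_self (r : ℤ) hm0).trans (hdvd_of _ (by simp [← ht, pow_orderOf_eq_one]))
    rw [← ZMod.intCast_zmod_eq_zero_iff_dvd] at h1 ⊢
    push_cast at h1 ⊢
    rwa [ZMod.pow_card_pow] at h1
  have hnot : ¬ (r : ℤ) ^ m ∣ (k : ℤ) ^ r ^ s - 1 := by
    intro h
    have h1 : d ^ ((k : ℤ) ^ r ^ s - 1) = 1 := by
      rw [← orderOf_dvd_iff_zpow_eq_one, hm]
      exact_mod_cast h
    rw [zpow_sub, zpow_one, ← Nat.cast_pow, zpow_natCast, ← hconjx, mul_inv_eq_one,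
      mul_inv_eq_iff_eq_mul] at h1
    exact hdy h1
  -- `hnorm` and `hnot` contradict the divisibility lemma outside its exceptional case `r = 2`, `s =
  -- 0`.
  have hrs : ¬ (r ≠ 2 ∨ s ≠ 0) := fun hrs => by
    refine hnot (prime_pow_dvd_of_dvd_geom_sum hr hk1 hrs ?_)
    have := orderOf_dvd_of_pow_eq_one hnorm
    rw [hm] at this
    exact_mod_cast this
  push Not at hrs
  obtain ⟨rfl, rfl⟩ := hrs
  rw [zero_add, pow_one] at ht hnorm
  have hinv : x * d * x⁻¹ = d⁻¹ := by
    have := hconjx 1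
    rw [pow_one, pow_one] at this
    rw [this, eq_inv_iff_mul_eq_one]
    simpa [Finset.sum_range_succ, pow_add, mul_comm, (Commute.refl d).pow_left k |>.eq] using hnorm
  refine ⟨rfl, x, d, v, hv, hxv, hx1, ?_, hdC.2, ⟨m, hm⟩, hinv, fun h => hdy ?_, fun h hh => ?_⟩
  · rw [← ht, pow_orderOf_eq_one]
  · rw [hy, pow_zero, pow_one, ← mul_inv_eq_iff_eq_mul, hinv, inv_eq_iff_mul_eq_one, ← sq, h]
  · obtain ⟨e, he, i, rfl⟩ := hdecomp h ((hmemP h).2 hh)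
    obtain ⟨j, rfl⟩ := mem_powers_iff_mem_zpowers.2 (hdgen e he)
    exact ⟨j, i, rfl⟩

end IsSemilinearAction

/-! ### Determination of `p` and `f` -/

theorem odd_and_mod_four_of_two_pow_dvd {p l m : ℕ} (hm : 2 ≤ m) (h : 2 ^ m ∣ p ^ l + 1) :
    Odd l ∧ p ≡ 3 [MOD 4] ∧ 2 ^ m ∣ p + 1 := by
  have h4 : (p ^ l + 1) % 4 = 0 := Nat.mod_eq_zero_of_dvd ((pow_dvd_pow 2 hm).trans h)
  have h4' : (p ^ l) % 4 = 3 := by omega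
  have hl : Odd l := by
    by_contra hl
    obtain ⟨j, rfl⟩ := Nat.not_odd_iff_even.1 hl
    rw [pow_add, Nat.mul_mod] at h4'
    have : (p ^ j) % 4 < 4 := Nat.mod_lt _ (by norm_num)
    generalize (p ^ j) % 4 = u at *
    interval_cases u <;> omega
  have hp : p % 4 = 3 := by
    obtain ⟨j, rfl⟩ := hl
    rw [pow_add, pow_mul, Nat.mul_mod, Nat.pow_mod, Nat.pow_mod p 2] at h4'
    have : p % 4 < 4 := Nat.mod_lt _ (by norm_num)
    rw [pow_one] at h4'
    generalize p % 4 = u at *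
    interval_cases u
    · simp at h4'
    · simp at h4'
    · norm_num at h4'
      generalize 0 ^ j = w at h4'
      omega
    · rfl
  refine ⟨hl, hp, ?_⟩
  have h1 : (∑ i ∈ Finset.range l, (-(p : ℤ)) ^ i) * (p + 1) = p ^ l + 1 := by
    have := geom_sum_mul (-(p : ℤ)) l
    rw [hl.neg_pow] at this
    linear_combination -this
  -- The cofactor of `p + 1` in `p ^ l + 1` is a sum of `l` odd terms with `l` odd, so `p + 1`
  -- carries the whole power of 2.
  have h2 : Odd (∑ i ∈ Finset.range l, (-(p : ℤ)) ^ i) := by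
    rw [← ZMod.natCast_eq_one_iff_odd] at hl
    rw [← ZMod.intCast_eq_one_iff_odd]
    have hp2 : (p : ZMod 2) = 1 := ZMod.natCast_eq_one_iff_odd.2 (Nat.odd_iff.2 (by omega))
    push_cast
    simp [hp2, hl]
  have h3 : IsCoprime ((2 : ℤ) ^ m) (∑ i ∈ Finset.range l, (-(p : ℤ)) ^ i) :=
    (Int.isCoprime_two_left.2 h2).pow_left
  have h4 : (2 : ℤ) ^ m ∣ (p : ℤ) ^ l + 1 := by exact_mod_cast h
  rw [← h1] at h4
  exact_mod_cast h3.dvd_of_dvd_mul_left h4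

theorem le_of_forall_pow_eq_self {F : Type*} [Field F] [Finite F] {p f n : ℕ} (hp : 1 < p)
    (hn : n ≠ 0) (hF : Nat.card F = p ^ f) (h : ∀ u : F, u ^ p ^ n = u) : f ≤ n := by
  obtain ⟨g, hg⟩ := IsCyclic.exists_generator (α := Fˣ)
  have hord : orderOf g = p ^ f - 1 := by
    rw [orderOf_eq_card_of_forall_mem_zpowers hg, Nat.card_units, hF]
  have hpn : 1 < p ^ n := Nat.one_lt_pow hn hp
  have h1 : g ^ (p ^ n - 1) = 1 := by
    refine mul_right_cancel (b := g) ?_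
    rw [← pow_succ, Nat.sub_add_cancel hpn.le, one_mul]
    ext
    simpa using h g
  have h2 := Nat.le_of_dvd (by omega) (orderOf_dvd_of_pow_eq_one h1)
  rw [hord] at h2
  exact (Nat.pow_le_pow_iff_right hp).1 (by omega)

namespace IsSemilinearAction

variable {H F : Type*} [Group H] [Field F] [MulAction H F] {a : H → F} {θ : H →* (F ≃+* F)}

/-- Classification of the irreducible nilpotent groups of semilinear maps of a finite field that
are generated by elements with nonzero fixed vectors. -/
theorem exists_dihedral_generators [FaithfulSMul H F] [Finite F] [Finite H] [Nontrivial H]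
    [Group.IsNilpotent H] (ha : IsSemilinearAction a θ)
    (hirr : ∀ W : AddSubgroup F, (∀ (h : H), ∀ w ∈ W, h • w ∈ W) → W = ⊥ ∨ W = ⊤)
    (hfix : Subgroup.closure {h : H | ∃ v : F, v ≠ 0 ∧ h • v = v} = ⊤)
    {p f : ℕ} [Fact p.Prime] [CharP F p] (hF : Nat.card F = p ^ f) (hf : 0 < f) :
    IsPGroup 2 H ∧ p ≡ 3 [MOD 4] ∧ f = 2 ∧ ∃ (x d : H) (v : F) (m : ℕ),
      v ≠ 0 ∧ x • v = v ∧ (∀ u, θ x u = u ^ p) ∧ x ^ 2 = 1 ∧ θ d = 1 ∧ orderOf d = 2 ^ m ∧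
      2 ^ m ∣ p + 1 ∧ x * d * x⁻¹ = d⁻¹ ∧ d ^ 2 ≠ 1 ∧ ∀ h : H, ∃ i j : ℕ, h = d ^ i * x ^ j := by
  have hp := Fact.out (p := p.Prime)
  have hcard : Nat.card H ≠ 0 := Nat.card_pos.ne'
  have h2 : ∀ {r : ℕ}, r.Prime → r ∣ Nat.card H → r = 2 := fun hr hrH =>
    (ha.exists_generators hirr hfix hr hrH).1
  obtain ⟨r, hr, hrH⟩ := Nat.exists_prime_and_dvd (Finite.one_lt_card (α := H)).ne'
  obtain rfl := h2 hr hrH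
  have hpow2 := Nat.eq_prime_pow_of_unique_prime_dvd hcard h2
  obtain ⟨-, x, d, v, hv, hxv, hx1, hx2, hd1, ⟨m, hm⟩, hxd, hd2, hgen⟩ :=
    ha.exists_generators hirr hfix hr hrH
  replace hgen : ∀ h : H, ∃ i j : ℕ, h = d ^ i * x ^ j := fun h =>
    hgen h ⟨_, by rw [← hpow2, pow_card_eq_one']⟩
  obtain ⟨l, hl⟩ := exists_forall_ringEquiv_eq_pow p (θ x)
  have hm2 : 2 ≤ m := by
    by_contra! hlt
    refine hd2 (orderOf_dvd_iff_pow_eq_one.1 ?_)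
    rw [hm]
    exact pow_dvd_pow 2 (Nat.lt_succ_iff.1 hlt) |>.trans (by norm_num)
  have hdvd : 2 ^ m ∣ p ^ l + 1 := by
    rw [← hm]
    refine orderOf_dvd_of_pow_eq_one ?_
    rw [pow_succ, ← ha.conj_eq_pow hd1 hl, hxd, inv_mul_cancel]
  obtain ⟨hlodd, hp4, hmp⟩ := odd_and_mod_four_of_two_pow_dvd hm2 hdvd
  have hδ : a d ^ p ^ 2 = a d := by
    have h1 : a d ^ (p + 1) = 1 := by
      obtain ⟨w, hw⟩ := hmp
      rw [← ha.coeff_pow hd1, hw, ← hm, pow_mul, pow_orderOf_eq_one, one_pow, ← ha.smul_one,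
        one_smul]
    have h3 : p ^ 2 = (p + 1) * (p - 1) + 1 := by
      obtain ⟨q, rfl⟩ := Nat.exists_eq_succ_of_ne_zero hp.ne_zero
      simp only [Nat.succ_eq_add_one, Nat.add_sub_cancel]
      ring
    rw [h3, pow_succ, pow_mul, h1, one_pow, one_mul]
  have hall : ∀ u : F, u ^ p ^ 2 = u := by
    -- `W` is `v` times the subfield fixed by `u ↦ u ^ p ^ 2`. It is invariant under `x`, and under
    -- `d` by `hδ`, so irreducibility makes it all of `F`.
    let W : AddSubgroup F :=
      { carrier := {u | (u / v) ^ p ^ 2 = u / v}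
        zero_mem' := by simp [hp.ne_zero]
        add_mem' := fun {u w} hu hw => by
          change ((u + w) / v) ^ p ^ 2 = (u + w) / v
          rw [add_div, add_pow_char_pow, hu, hw]
        neg_mem' := fun {u} hu => by
          change ((-u) / v) ^ p ^ 2 = (-u) / v
          have := map_neg (iterateFrobenius F p 2) (u / v)
          simp only [iterateFrobenius_def] at this
          rw [neg_div, this, hu] }
    have hW : ∀ u, u ∈ W ↔ (u / v) ^ p ^ 2 = u / v := fun _ => Iff.rfl
    have hWd : ∀ u ∈ W, ∀ i : ℕ, d ^ i • u ∈ W := fun u hu i => by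
      rw [hW, ha.smul_of_eq_one (by rw [map_pow, hd1, one_pow]), ha.coeff_pow hd1,
        mul_div_assoc, mul_pow, (hW u).1 hu, pow_right_comm, hδ]
    have hWx : ∀ u ∈ W, ∀ j : ℕ, x ^ j • u ∈ W := fun u hu j => by
      rw [hW, ha.smul_pow_of_fixed hv hxv, mul_div_cancel_left₀ _ hv, ← map_pow, (hW u).1 hu]
    rcases hirr W fun h w hw => by
        obtain ⟨i, j, rfl⟩ := hgen h
        rw [mul_smul]
        exact hWd _ (hWx w hw j) i with h | h
    · refine absurd ?_ hv
      rw [← AddSubgroup.mem_bot, ← h, hW, div_self hv, one_pow]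
    · intro u
      have := (hW (v * u)).1 (h ▸ AddSubgroup.mem_top _)
      rwa [mul_div_cancel_left₀ _ hv] at this
  have hf2 : f ≤ 2 := le_of_forall_pow_eq_self hp.one_lt two_ne_zero hF hall
  have hθ1 : θ x ≠ 1 := fun h => hx1 (ha.eq_one_of_fixed h hv hxv)
  have hf1 : f ≠ 1 := by
    rintro rfl
    have := Fintype.ofFinite F
    refine hθ1 (RingEquiv.ext fun u => ?_)
    rw [hl, RingAut.one_apply, ← pow_one p, ← hF, Nat.card_eq_fintype_card,
      FiniteField.pow_card_pow]
  have hθx : ∀ u, θ x u = u ^ p := by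
    intro u
    obtain ⟨j, rfl⟩ := hlodd
    have : ∀ j : ℕ, u ^ p ^ (2 * j) = u := fun j => by
      induction j with
      | zero => simp
      | succ j ih => rw [mul_add, pow_add, pow_mul, ih, mul_one, hall]
    rw [hl, pow_add, pow_mul, this, pow_one]
  refine ⟨IsPGroup.of_card hpow2, hp4, by omega, x, d, v, m, hv, hxv, hθx, hx2, hd1, hm, hmp, hxd,
    hd2, hgen⟩

end IsSemilinearAction

/-! ### Affine groups: translations and linear parts -/

theorem exists_isSemilinearAction {F : Type*} [Field F] (H : Subgroup (Equiv.Perm F))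
    (hH : ∀ h ∈ H, ∃ (a : Fˣ) (τ : F ≃+* F), ∀ x, h x = a * τ x) :
    ∃ θ : H →* (F ≃+* F), IsSemilinearAction (fun h : H => (h : Equiv.Perm F) 1) θ := by
  have key : ∀ h : H, ∃ τ : F ≃+* F, (h : Equiv.Perm F) 1 ≠ 0 ∧
      ∀ x, (h : Equiv.Perm F) x = (h : Equiv.Perm F) 1 * τ x := by
    intro h
    obtain ⟨a, τ, ha⟩ := hH h h.2
    have h1 : (h : Equiv.Perm F) 1 = a := by rw [ha, map_one, mul_one]
    exact ⟨τ, h1 ▸ a.ne_zero, fun x => by rw [h1, ha]⟩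
  choose θ hne hθ using key
  refine ⟨MonoidHom.mk' θ fun g h => ?_, ⟨hne, hθ⟩⟩
  ext x
  refine mul_left_cancel₀ (hne (g * h)) ?_
  rw [← hθ]
  simp only [Subgroup.coe_mul, Equiv.Perm.mul_apply, RingAut.mul_apply]
  rw [hθ h x, hθ g, map_mul, ← mul_assoc, ← hθ g]

section Affine

variable {F : Type*} [Field F] {G H : Subgroup (Equiv.Perm F)}

theorem apply_sub_of_mem_affineSemilinearGroup {g : Equiv.Perm F}
    (hg : g ∈ affineSemilinearGroup F) (u w : F) : g (u - w) = g u - g w + g 0 := by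
  obtain ⟨a, τ, b, h⟩ := hg
  simp only [h, map_sub, map_zero]
  ring

theorem apply_add_of_mem_affineSemilinearGroup {g : Equiv.Perm F}
    (hg : g ∈ affineSemilinearGroup F) (u w : F) : g (u + w) = g u + g w - g 0 := by
  obtain ⟨a, τ, b, h⟩ := hg
  simp only [h, map_add, map_zero]
  ring

/-- The translations in a group `G` containing all of them. -/
def translationHom (hV : translationGroup F ≤ G) : Multiplicative F →* G :=
  MonoidHom.mk' (fun b => ⟨Equiv.addRight b.toAdd, hV ⟨b.toAdd, fun _ => rfl⟩⟩) fun b c => by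
    ext x
    simp [add_comm, add_left_comm]

theorem translationHom_apply (hV : translationGroup F ≤ G) (b : Multiplicative F) (x : F) :
    (translationHom hV b : Equiv.Perm F) x = x + b.toAdd := rfl

/-- The linear part `x ↦ g x - g 0` of an element of an affine group. -/
def linearPart (hG : G ≤ affineSemilinearGroup F) (hV : translationGroup F ≤ G)
    (hH : H = G ⊓ MulAction.stabilizer (Equiv.Perm F) (0 : F)) : G →* H :=
  MonoidHom.mk' (fun g => ⟨Equiv.addRight (-(g : Equiv.Perm F) 0) * g, by
    rw [hH]
    refine ⟨mul_mem (hV ⟨-(g : Equiv.Perm F) 0, fun _ => rfl⟩) g.2, ?_⟩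
    change (g : Equiv.Perm F) 0 + -(g : Equiv.Perm F) 0 = 0
    ring⟩) fun g h => by
    ext x
    change (g : Equiv.Perm F) ((h : Equiv.Perm F) x) + -(g : Equiv.Perm F) ((h : Equiv.Perm F) 0) =
      (g : Equiv.Perm F) ((h : Equiv.Perm F) x + -(h : Equiv.Perm F) 0) + -(g : Equiv.Perm F) 0
    rw [← sub_eq_add_neg _ ((h : Equiv.Perm F) 0),
      apply_sub_of_mem_affineSemilinearGroup (hG g.2)]
    ring

variable (hG : G ≤ affineSemilinearGroup F) (hV : translationGroup F ≤ G)
  (hH : H = G ⊓ MulAction.stabilizer (Equiv.Perm F) (0 : F))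

theorem linearPart_apply (g : G) (x : F) :
    (linearPart hG hV hH g : Equiv.Perm F) x = (g : Equiv.Perm F) x - (g : Equiv.Perm F) 0 :=
  (sub_eq_add_neg _ _).symm

theorem apply_zero_of_mem_stabilizer {h : Equiv.Perm F}
    (hH : H = G ⊓ MulAction.stabilizer (Equiv.Perm F) (0 : F)) (hh : h ∈ H) : h 0 = 0 := by
  rw [hH] at hh
  exact hh.2

theorem linearPart_surjective : Function.Surjective (linearPart hG hV hH) := fun h => by
  refine ⟨⟨h, (hH.le h.2).1⟩, ?_⟩
  ext x
  rw [linearPart_apply, apply_zero_of_mem_stabilizer hH h.2, sub_zero]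

theorem ker_linearPart : (linearPart hG hV hH).ker = (translationGroup F).subgroupOf G := by
  ext g
  rw [MonoidHom.mem_ker, Subgroup.mem_subgroupOf]
  constructor
  · intro h
    refine ⟨(g : Equiv.Perm F) 0, fun x => ?_⟩
    have h1 := linearPart_apply hG hV hH g x
    rw [h] at h1
    change x = _ at h1
    change (g : Equiv.Perm F) x = x + (g : Equiv.Perm F) 0
    linear_combination -h1
  · rintro ⟨b, hb⟩
    ext x
    rw [linearPart_apply, hb, hb]
    change x + b - (0 + b) = x
    ring

theorem eq_translationHom_mul_linearPart (g : G) :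
    (g : Equiv.Perm F) = translationHom hV (Multiplicative.ofAdd ((g : Equiv.Perm F) 0)) *
      linearPart hG hV hH g := by
  ext x
  rw [Equiv.Perm.mul_apply, linearPart_apply, translationHom_apply]
  simp

include hG in
theorem exists_semilinear_of_mem_stabilizer
    (hH : H = G ⊓ MulAction.stabilizer (Equiv.Perm F) (0 : F)) :
    ∀ h ∈ H, ∃ (a : Fˣ) (τ : F ≃+* F), ∀ x, h x = a * τ x := by
  intro h hh
  obtain ⟨a, τ, b, hab⟩ := hG (hH.le hh).1
  have h0 := apply_zero_of_mem_stabilizer hH hh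
  rw [hab, map_zero, mul_zero, zero_add] at h0
  exact ⟨a, τ, fun x => by rw [hab, h0, add_zero]⟩

-- An `H`-invariant additive subgroup is a block of `G` containing `0`.
open scoped Pointwise in
theorem stabilizer_irreducible (hG : G ≤ affineSemilinearGroup F) (hV : translationGroup F ≤ G)
    (hprim : MulAction.IsPreprimitive G F)
    (hH : H = G ⊓ MulAction.stabilizer (Equiv.Perm F) (0 : F)) (W : AddSubgroup F)
    (hW : ∀ (h : H), ∀ w ∈ W, h • w ∈ W) : W = ⊥ ∨ W = ⊤ := by
  have hsub : ∀ (g : G) (x y : F), x ∈ W → y ∈ W → g • x - g • y ∈ W := by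
    intro g x y hx hy
    have h1 := hW (linearPart hG hV hH g) (x - y) (W.sub_mem hx hy)
    change (linearPart hG hV hH g : Equiv.Perm F) (x - y) ∈ W at h1
    rw [linearPart_apply, apply_sub_of_mem_affineSemilinearGroup (hG g.2),
      add_sub_cancel_right] at h1
    exact h1
  have hle : ∀ (g : G) (x : F), x ∈ W → g • x ∈ W → g • (W : Set F) ⊆ W := by
    rintro g x hx hgx _ ⟨y, hy, rfl⟩
    have := W.add_mem (hsub g y x hy hx) hgx
    rwa [sub_add_cancel] at this
  have hblock : MulAction.IsBlock G (W : Set F) := by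
    rw [MulAction.isBlock_iff_smul_eq_of_mem]
    intro g x hx hgx
    refine (hle g x hx hgx).antisymm ?_
    rw [Set.subset_smul_set_iff]
    exact hle g⁻¹ (g • x) hgx (by rwa [inv_smul_smul])
  rcases hprim.isTrivialBlock_of_isBlock hblock with h | h
  · exact .inl ((AddSubgroup.eq_bot_iff_forall _).2 fun x hx => h hx W.zero_mem)
  · exact .inr (AddSubgroup.coe_eq_univ.1 h)

theorem translation_mul_comm : ∀ x ∈ (translationGroup F).subgroupOf G,
    ∀ y ∈ (translationGroup F).subgroupOf G, x * y = y * x := by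
  rintro x ⟨b, hb⟩ y ⟨c, hc⟩
  ext u
  change (x : Equiv.Perm F) ((y : Equiv.Perm F) u) = (y : Equiv.Perm F) ((x : Equiv.Perm F) u)
  simp only [Subgroup.coe_subtype] at hb hc
  rw [hb, hc, hb, hc]
  ring

theorem translationHom_mem (b : Multiplicative F) :
    translationHom hV b ∈ (translationGroup F).subgroupOf G :=
  ⟨b.toAdd, fun _ => rfl⟩

theorem exists_eq_translationHom {g : G} (hg : g ∈ (translationGroup F).subgroupOf G) :
    ∃ b, g = translationHom hV b := by
  obtain ⟨b, hb⟩ := hg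
  exact ⟨Multiplicative.ofAdd b, by ext x; exact hb x⟩

/-- Normal subgroups of `G` inside `V` correspond to `H`-invariant additive subgroups of `F`. -/
theorem isMinimalNormal_translation (hG : G ≤ affineSemilinearGroup F)
    (hV : translationGroup F ≤ G) (hprim : MulAction.IsPreprimitive G F) :
    IsMinimalNormal ((translationGroup F).subgroupOf G) := by
  refine ⟨ker_linearPart hG hV rfl ▸ inferInstance, fun h => ?_, fun M hM hM1 hMV => ?_⟩
  · have h1 := translationHom_mem hV (Multiplicative.ofAdd 1)
    rw [h, Subgroup.mem_bot] at h1
    have h2 := translationHom_apply hV (Multiplicative.ofAdd 1) 0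
    rw [h1] at h2
    simp at h2
  · let W : AddSubgroup F := (M.comap (translationHom hV)).toAddSubgroup'
    have hW : ∀ b, b ∈ W ↔ translationHom hV (Multiplicative.ofAdd b) ∈ M := fun _ => Iff.rfl
    rcases stabilizer_irreducible hG hV hprim rfl W fun h w hw => by
        have h1 := hM.conj_mem _ ((hW w).1 hw) ⟨h, h.2.1⟩
        rw [hW]
        convert h1 using 1
        rw [eq_mul_inv_iff_mul_eq]
        ext x
        change (h : Equiv.Perm F) x + (h : Equiv.Perm F) w = (h : Equiv.Perm F) (x + w)
        rw [apply_add_of_mem_affineSemilinearGroup (hG h.2.1),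
          apply_zero_of_mem_stabilizer rfl h.2, sub_zero]
      with h | h
    · refine absurd ((Subgroup.eq_bot_iff_forall _).2 fun g hg => ?_) hM1
      obtain ⟨b, rfl⟩ := exists_eq_translationHom hV (hMV hg)
      have : b.toAdd ∈ W := hg
      rw [h, AddSubgroup.mem_bot] at this
      rw [toAdd_eq_zero.1 this, map_one]
    · refine le_antisymm hMV fun g hg => ?_
      obtain ⟨b, rfl⟩ := exists_eq_translationHom hV hg
      exact (hW b.toAdd).1 (h ▸ AddSubgroup.mem_top _)

/-- A normal subgroup meeting `V` trivially commutes with `V`; but a permutation `w` commuting with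
all translations is the translation by `w 0`. -/
theorem eq_translation_of_isMinimalNormal (hG : G ≤ affineSemilinearGroup F)
    (hV : translationGroup F ≤ G) (hprim : MulAction.IsPreprimitive G F) {W : Subgroup G}
    (hW : IsMinimalNormal W) : W = (translationGroup F).subgroupOf G := by
  have hmin := isMinimalNormal_translation hG hV hprim
  have hWn := hW.1
  have hVn := hmin.1
  by_cases hd : W ⊓ (translationGroup F).subgroupOf G = ⊥
  · refine absurd ((Subgroup.eq_bot_iff_forall _).2 fun w hw => ?_) hW.2.1
    have hwV : w ∈ (translationGroup F).subgroupOf G := by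
      refine ⟨(w : Equiv.Perm F) 0, fun x => ?_⟩
      have h1 := Subgroup.commute_of_normal_of_disjoint _ _ hWn hVn (disjoint_iff.2 hd) w _ hw
        (translationHom_mem hV (Multiplicative.ofAdd x))
      have h2 := congrArg (fun g : G => (g : Equiv.Perm F) 0) h1.eq
      simp only [Subgroup.coe_mul, Equiv.Perm.mul_apply, translationHom_apply, toAdd_ofAdd,
        zero_add] at h2
      exact h2.trans (add_comm _ _)
    rw [← Subgroup.mem_bot, ← hd]
    exact ⟨hw, hwV⟩
  · rw [← hmin.2.2 _ inferInstance hd inf_le_right]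
    exact (hW.2.2 _ inferInstance hd inf_le_left).symm

/-- If `H` were trivial, every additive subgroup would be invariant, so `1` would generate `F`
additively and `G = V` would be cyclic. -/
theorem nontrivial_stabilizer (hG : G ≤ affineSemilinearGroup F) (hV : translationGroup F ≤ G)
    (hprim : MulAction.IsPreprimitive G F)
    (hH : H = G ⊓ MulAction.stabilizer (Equiv.Perm F) (0 : F)) (hcyc : ¬ IsCyclic G) :
    Nontrivial H := by
  by_contra hH1
  rw [not_nontrivial_iff_subsingleton] at hH1
  refine hcyc ⟨translationHom hV (Multiplicative.ofAdd 1), fun g => ?_⟩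
  have hg : g ∈ (translationGroup F).subgroupOf G := by
    rw [← ker_linearPart hG hV hH]
    exact Subsingleton.elim _ _
  obtain ⟨b, rfl⟩ := exists_eq_translationHom hV hg
  have h1 : AddSubgroup.zmultiples (1 : F) = ⊤ := by
    refine (stabilizer_irreducible hG hV hprim hH _ fun h w hw => ?_).resolve_left ?_
    · rwa [Subsingleton.elim h 1, one_smul]
    · simp
  obtain ⟨n, hn⟩ := AddSubgroup.mem_zmultiples_iff.1 (h1.ge (AddSubgroup.mem_top b.toAdd))
  refine ⟨n, ?_⟩
  change _ ^ n = _
  rw [← map_zpow, ← ofAdd_zsmul, hn, ofAdd_toAdd]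

/-- If the elements of the point stabilizer `H` with a nonzero fixed vector generate a proper
subgroup `R`, then `G` is covered by the conjugates of `H` and `V R`. -/
theorem closure_fixed_eq_top_of_not_hasTwoCover [Finite F] (hG : G ≤ affineSemilinearGroup F)
    (hV : translationGroup F ≤ G)
    (hH : H = G ⊓ MulAction.stabilizer (Equiv.Perm F) (0 : F)) (hcov : ¬ HasTwoCover G) :
    Subgroup.closure {h : H | ∃ v : F, v ≠ 0 ∧ h • v = v} = ⊤ := by
  by_contra hR
  refine hcov ⟨H.subgroupOf G, (Subgroup.closure {h : H | ∃ v : F, v ≠ 0 ∧ h • v = v}).comap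
    (linearPart hG hV hH), fun h => ?_, ?_, fun g => ?_⟩
  · have h1 : translationHom hV (Multiplicative.ofAdd 1) ∈ H.subgroupOf G :=
      h ▸ Subgroup.mem_top _
    have h2 := apply_zero_of_mem_stabilizer hH (Subgroup.mem_subgroupOf.1 h1)
    rw [translationHom_apply] at h2
    simp at h2
  · rwa [← Subgroup.comap_top (linearPart hG hV hH),
      (Subgroup.comap_injective (linearPart_surjective hG hV hH)).ne_iff]
  · by_cases hg : linearPart hG hV hH g ∈ {h : H | ∃ v : F, v ≠ 0 ∧ h • v = v}
    · refine ⟨1, .inr ?_⟩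
      rw [one_mul, inv_one, mul_one]
      exact Subgroup.subset_closure hg
    -- Without nonzero fixed vectors for its linear part `L`, `u ↦ u - L u` is bijective, so `g`
    -- fixes a point, which a translation moves to `0`.
    · have hinj : Function.Injective fun u : F => u - (linearPart hG hV hH g : Equiv.Perm F) u := by
        intro u w huw
        by_contra hne
        refine hg ⟨u - w, sub_ne_zero.2 hne, ?_⟩
        change (linearPart hG hV hH g : Equiv.Perm F) (u - w) = u - w
        simp only [linearPart_apply] at huw ⊢
        rw [apply_sub_of_mem_affineSemilinearGroup (hG g.2)]
        linear_combination -huw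
      obtain ⟨w, hw⟩ := (Finite.injective_iff_surjective.1 hinj) ((g : Equiv.Perm F) 0)
      have hgw : (g : Equiv.Perm F) w = w := by
        simp only [linearPart_apply] at hw
        linear_combination -hw
      refine ⟨(translationHom hV (Multiplicative.ofAdd w))⁻¹, .inl ?_⟩
      rw [Subgroup.mem_subgroupOf, hH]
      refine ⟨Subtype.property _, ?_⟩
      rw [inv_inv, ← map_inv, ← ofAdd_neg]
      change (translationHom hV (Multiplicative.ofAdd (-w)) : Equiv.Perm F) ((g : Equiv.Perm F)
        ((translationHom hV (Multiplicative.ofAdd w) : Equiv.Perm F) 0)) = 0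
      rw [translationHom_apply, translationHom_apply, toAdd_ofAdd, toAdd_ofAdd, zero_add, hgw,
        add_neg_cancel]

end Affine

/-! ### The two directions of the theorem -/

section

variable {F : Type*} [Field F] {G H : Subgroup (Equiv.Perm F)}

/-- `G ⧸ V` is isomorphic to the point stabilizer. -/
theorem nonempty_quotient_mulEquiv (hG : G ≤ affineSemilinearGroup F)
    (hV : translationGroup F ≤ G)
    (hH : H = G ⊓ MulAction.stabilizer (Equiv.Perm F) (0 : F))
    [((translationGroup F).subgroupOf G).Normal] :
    Nonempty (G ⧸ (translationGroup F).subgroupOf G ≃* H) :=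
  ⟨(QuotientGroup.quotientMulEquivOfEq (ker_linearPart hG hV hH).symm).trans
    (QuotientGroup.quotientKerEquivOfSurjective _ (linearPart_surjective hG hV hH))⟩

theorem isNonBasicOfAffineType_iff [Finite F] (hG : G ≤ affineSemilinearGroup F)
    (hV : translationGroup F ≤ G) (hprim : MulAction.IsPreprimitive G F)
    (hH : H = G ⊓ MulAction.stabilizer (Equiv.Perm F) (0 : F)) :
    IsNonBasicOfAffineType G ↔ ¬ HasTwoCover H ∧ ¬ HasTwoCover G := by
  have hmin := isMinimalNormal_translation hG hV hprim
  have hn := hmin.1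
  obtain ⟨e⟩ := nonempty_quotient_mulEquiv hG hV hH
  have he : HasTwoCover (G ⧸ (translationGroup F).subgroupOf G) ↔ HasTwoCover H :=
    ⟨.of_surjective e.symm.toMonoidHom e.symm.surjective,
      .of_surjective e.toMonoidHom e.surjective⟩
  rw [← he]
  constructor
  · rintro ⟨V, hVn, hVmin, -, -, h1, h2⟩
    obtain rfl := eq_translation_of_isMinimalNormal hG hV hprim hVmin
    exact ⟨normalCoveringNumber_eq_two_iff.not.1 h1, normalCoveringNumber_eq_two_iff.not.1 h2⟩
  · rintro ⟨h1, h2⟩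
    exact ⟨_, hn, hmin, fun W hW => eq_translation_of_isMinimalNormal hG hV hprim hW,
      translation_mul_comm, normalCoveringNumber_eq_two_iff.not.2 h1,
      normalCoveringNumber_eq_two_iff.not.2 h2⟩

theorem stabilizer_eq_dihedral_of_not_hasTwoCover [Finite F] {p f : ℕ} [Fact p.Prime] (hf : 0 < f)
    [CharP F p] (hq : Nat.card F = p ^ f) (lam : Fˣ)
    (hlam : ∀ x : Fˣ, x ∈ Subgroup.zpowers lam) (hG : G ≤ affineSemilinearGroup F)
    (hV : translationGroup F ≤ G) (hprim : MulAction.IsPreprimitive G F)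
    (hH : H = G ⊓ MulAction.stabilizer (Equiv.Perm F) (0 : F)) (hcyc : ¬ IsCyclic G)
    (hcovH : ¬ HasTwoCover H) (hcovG : ¬ HasTwoCover G) :
    p ≡ 3 [MOD 4] ∧ f = 2 ∧ (IsPGroup 2 H ∧ IsDihedral H) ∧
      ∃ e : ℕ, e ∣ p + 1 ∧ ∃ a : Fˣ,
        H.map (MulAut.conj (scalarPerm a)).toMonoidHom =
          Subgroup.closure {frobeniusPerm F p, scalarPerm (lam ^ ((p - 1) * e))} := by
  have hp := Fact.out (p := p.Prime)
  obtain ⟨θ, ha⟩ := exists_isSemilinearAction H (exists_semilinear_of_mem_stabilizer hG hH)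
  have := nontrivial_stabilizer hG hV hprim hH hcyc
  have := ha.isNilpotent hcovH
  obtain ⟨hH2, hp4, rfl, x, d, v, m, hv, hxv, hθx, hx2, hd1, hm, ⟨e, he⟩, hxd, hd2, hgen⟩ :=
    ha.exists_dihedral_generators (stabilizer_irreducible hG hV hprim hH)
      (closure_fixed_eq_top_of_not_hasTwoCover hG hV hH hcovG) hq hf
  have hxpow : ∀ j : ℕ, x ^ j = 1 ∨ x ^ j = x := fun j => by
    obtain ⟨k, rfl | rfl⟩ := Nat.even_or_odd' j
    · exact .inl (by rw [pow_mul, hx2, one_pow])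
    · exact .inr (by rw [pow_succ, pow_mul, hx2, one_pow, one_mul])
  -- Here `e = (p + 1) / 2 ^ m`, and conjugation by `v⁻¹` moves the fixed vector of `x` to `1`,
  -- making `x` the Frobenius.
  refine ⟨hp4, rfl, ⟨hH2, isDihedral_of_generators d x (hm ▸ by positivity) (by rw [← sq, hx2]) hxd
    (fun h => hd2 ?_) fun h => ?_⟩, e, ⟨2 ^ m, by rw [he, mul_comm]⟩,
    Units.mk0 v⁻¹ (inv_ne_zero hv), ?_⟩
  · obtain ⟨j, rfl⟩ := h
    have : d = d⁻¹ := by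
      rw [← hxd, ((Commute.refl d).zpow_left j).eq, mul_inv_cancel_right]
    rw [sq]
    nth_rewrite 2 [this]
    rw [mul_inv_cancel]
  · obtain ⟨i, j, rfl⟩ := hgen h
    rcases hxpow j with hj | hj
    · exact .inl (by rw [hj, mul_one]; exact pow_mem (Subgroup.mem_zpowers d) i)
    · refine .inr ?_
      rw [hj, ← mul_assoc]
      have hxinv : x = x⁻¹ := eq_inv_of_mul_eq_one_left (by rw [← sq, hx2])
      nth_rewrite 2 [hxinv]
      rw [← conj_pow, hxd]
      exact pow_mem (inv_mem (Subgroup.mem_zpowers d)) i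
  · have hcl : H = Subgroup.closure {(x : Equiv.Perm F), (d : Equiv.Perm F)} := by
      refine le_antisymm (fun h hh => ?_) ?_
      · obtain ⟨i, j, hij⟩ := hgen ⟨h, hh⟩
        rw [show h = (d : Equiv.Perm F) ^ i * (x : Equiv.Perm F) ^ j from congrArg Subtype.val hij]
        exact mul_mem (pow_mem (Subgroup.subset_closure (by simp)) i)
          (pow_mem (Subgroup.subset_closure (by simp)) j)
      · rw [Subgroup.closure_le]
        rintro _ (rfl | rfl) <;> exact Subtype.property _
    have hδ : scalarPerm (Units.mk0 ((d : Equiv.Perm F) 1) (ha.ne_zero d)) = (d : Equiv.Perm F) := by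
      ext u
      exact (ha.smul_of_eq_one hd1 u).symm
    set δ := Units.mk0 ((d : Equiv.Perm F) 1) (ha.ne_zero d) with hδdef
    have hpow : ∀ (b : Fˣ) (k : ℤ), scalarPerm (b ^ k) = scalarPerm b ^ k := fun b k =>
      map_zpow (MulAction.toPermHom Fˣ F) b k
    have hcx : (MulAut.conj (scalarPerm (Units.mk0 v⁻¹ (inv_ne_zero hv)))).toMonoidHom
        (x : Equiv.Perm F) = frobeniusPerm F p := by
      change scalarPerm _ * (x : Equiv.Perm F) * (scalarPerm _)⁻¹ = _
      rw [mul_inv_eq_iff_eq_mul]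
      ext u
      have h1 := ha.smul_pow_of_fixed hv hxv 1 u
      rw [pow_one, pow_one, hθx] at h1
      change v⁻¹ * (x : Equiv.Perm F) u = (v⁻¹ * u) ^ p
      rw [show (x : Equiv.Perm F) u = _ from h1, inv_mul_cancel_left₀ hv, div_eq_inv_mul]
    have hcd : (MulAut.conj (scalarPerm (Units.mk0 v⁻¹ (inv_ne_zero hv)))).toMonoidHom
        (d : Equiv.Perm F) = scalarPerm δ := by
      change scalarPerm _ * (d : Equiv.Perm F) * (scalarPerm _)⁻¹ = _
      rw [mul_inv_eq_iff_eq_mul, ← hδ]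
      ext u
      change v⁻¹ * ((δ : F) * u) = δ * (v⁻¹ * u)
      ring
    have hordδ : orderOf δ = 2 ^ m := by
      rw [← hm, ← Subgroup.orderOf_coe, ← hδ]
      exact (orderOf_injective (MulAction.toPermHom Fˣ F) MulAction.toPerm_injective δ).symm
    -- Since `p ^ 2 - 1 = (p - 1) * e * 2 ^ m`, this power of `lam` has the same order as `δ`, so
    -- both generate the same subgroup of the cyclic group `Fˣ`.
    have hordlam : orderOf (lam ^ ((p - 1) * e)) = 2 ^ m := by
      have hp1 : 0 < p - 1 := Nat.sub_pos_of_lt hp.one_lt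
      have he0 : 0 < e := Nat.pos_of_ne_zero (by rintro rfl; omega)
      have h1 : orderOf lam = (p - 1) * e * 2 ^ m := by
        rw [orderOf_eq_card_of_forall_mem_zpowers hlam, Nat.card_units, hq, mul_assoc, mul_comm e,
          ← he, mul_comm, ← Nat.sq_sub_sq, one_pow]
      rw [orderOf_pow_of_dvd (by positivity) (h1 ▸ dvd_mul_right _ _), h1,
        Nat.mul_div_cancel_left _ (by positivity)]
    have hmem : ∀ b c : Fˣ, orderOf b = orderOf c →
        scalarPerm b ∈ Subgroup.closure {frobeniusPerm F p, scalarPerm c} := fun b c hbc => by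
      obtain ⟨k, rfl⟩ := Subgroup.mem_zpowers_iff.1
        (mem_zpowers_of_orderOf_dvd_orderOf (a := c) (b := b) hbc.dvd)
      rw [hpow]
      exact zpow_mem (Subgroup.subset_closure (by simp)) k
    rw [hcl, MonoidHom.map_closure, Set.image_pair, hcx, hcd]
    refine le_antisymm ?_ ?_ <;> rw [Subgroup.closure_le] <;> rintro _ (rfl | rfl)
    · exact Subgroup.subset_closure (by simp)
    · exact hmem _ _ (hordδ.trans hordlam.symm)
    · exact Subgroup.subset_closure (by simp)
    · exact hmem _ _ (hordlam.trans hordδ.symm)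

theorem not_hasTwoCover_of_isPGroup_stabilizer [Finite F] {p : ℕ} [Fact p.Prime] [CharP F p]
    (hq : Nat.card F = p ^ 2) (lam : Fˣ) (hG : G ≤ affineSemilinearGroup F)
    (hV : translationGroup F ≤ G) (hprim : MulAction.IsPreprimitive G F)
    (hH : H = G ⊓ MulAction.stabilizer (Equiv.Perm F) (0 : F)) (hH2 : IsPGroup 2 H) {e : ℕ}
    {a : Fˣ} (hHa : H.map (MulAut.conj (scalarPerm a)).toMonoidHom =
      Subgroup.closure {frobeniusPerm F p, scalarPerm (lam ^ ((p - 1) * e))}) :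
    ¬ HasTwoCover G := by
  have hp := Fact.out (p := p.Prime)
  have hmin := isMinimalNormal_translation hG hV hprim
  have hn := hmin.1
  obtain ⟨E⟩ := nonempty_quotient_mulEquiv hG hV hH
  have hpow : ∀ u : F, u ^ p ^ 2 = u := fun u => by
    have := Fintype.ofFinite F
    rw [← hq, Nat.card_eq_fintype_card, FiniteField.pow_card]
  refine not_hasTwoCover_of_isPGroup_quotient hmin translation_mul_comm (hH2.of_equiv E.symm)
    fun M hVM hM => ?_
  -- elements `x ↦ β x ^ p` with `β ^ (p + 1) = 1` lie in `M`
  have hrefl : ∀ (h : G) (β : F), β ^ (p + 1) = 1 → (∀ x, (h : Equiv.Perm F) x = β * x ^ p) →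
      h ∈ M := by
    intro h β hβ hx
    -- `β b ^ p + b` is the translation by which the square of `x ↦ β x ^ p + b` acts. If it
    -- vanished for all `b`, then `β = -1` (take `b = 1`) and `b ^ p = b` on a field of `p ^ 2`
    -- elements.
    obtain ⟨b, hb⟩ : ∃ b : F, β * b ^ p + b ≠ 0 := by
      by_contra! hall
      have h1 : β = -1 := by
        have := hall 1
        rw [one_pow, mul_one] at this
        exact eq_neg_of_add_eq_zero_left this
      have h2 := le_of_forall_pow_eq_self hp.one_lt one_ne_zero hq fun u => by
        have := hall u
        rw [h1] at this
        rw [pow_one]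
        linear_combination -this
      omega
    have hsq : ∀ u, ((translationHom hV (Multiplicative.ofAdd b) * h) ^ 2 : G).1 u =
        u + (β * b ^ p + b) := fun u => by
      rw [sq]
      change (h : Equiv.Perm F) ((h : Equiv.Perm F) u + b) + b = _
      rw [hx, hx, add_pow_char, mul_pow, ← pow_mul, ← sq, hpow]
      linear_combination u * hβ
    have h1 : translationHom hV (Multiplicative.ofAdd b) * h ∈ M := by
      refine hM _ ⟨_, hsq⟩ fun h1 => hb ?_
      have := hsq 0
      rw [h1, zero_add] at this
      exact this.symm
    exact (M.mul_mem_cancel_left (hVM (translationHom_mem hV _))).1 h1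
  set μ := lam ^ ((p - 1) * e) with hμ
  have hμ1 : μ ^ (p + 1) = 1 := by
    have h1 : lam ^ (p ^ 2 - 1) = 1 := by
      rw [← hq, ← Nat.card_units, pow_card_eq_one']
    rw [hμ, ← pow_mul, mul_right_comm, mul_comm (p - 1), ← Nat.sq_sub_sq p 1, pow_mul, one_pow, h1,
      one_pow]
  set φ := (MulAut.conj (scalarPerm a)).toMonoidHom with hφ
  have hφinj : Function.Injective φ := (MulAut.conj (scalarPerm a)).injective
  -- Undoing the conjugation by `a` multiplies the coefficient by `a ^ (p - 1)`, whose `(p + 1)`-th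
  -- power is `1`.
  have hmem : ∀ (s : Equiv.Perm F) (ν : Fˣ), ν ^ (p + 1) = 1 → (∀ x, s x = ν * x ^ p) →
      s ∈ H.map φ → s ∈ (M.map G.subtype).map φ := by
    rintro s ν hν hs ⟨h, hh, rfl⟩
    have hhG : h ∈ G := (hH.le hh).1
    refine ⟨h, ⟨⟨h, hhG⟩, hrefl _ (ν * a ^ p * (a : F)⁻¹) ?_ (fun x => ?_), rfl⟩, rfl⟩
    · have h1 : (ν : F) ^ (p + 1) = 1 := by rw [← Units.val_pow_eq_pow_val, hν, Units.val_one]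
      have h2 : ((a : F) ^ p) ^ (p + 1) = (a : F) ^ (p + 1) := by
        rw [← pow_mul, mul_add, ← sq, mul_one, pow_add, hpow, pow_succ']
      rw [mul_pow, mul_pow, h1, h2, one_mul, ← mul_pow, mul_inv_cancel₀ a.ne_zero, one_pow]
    · have h1 := hs (a * x)
      have h2 : (φ h) (a * x) = a * h x := by
        change (scalarPerm a * h * (scalarPerm a)⁻¹) (scalarPerm a x) = _
        simp
        rfl
      rw [h2] at h1
      change h x = _
      rw [← mul_right_inj' a.ne_zero, h1, mul_pow]
      field_simp
  have hσ : frobeniusPerm F p ∈ (M.map G.subtype).map φ :=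
    hmem _ 1 (one_pow _) (fun x => by simp [frobeniusPerm, frobenius_def])
      (hHa ▸ Subgroup.subset_closure (by simp))
  -- The scalar `μ` is reached as the quotient of the two maps `μσ` and `σ`, to both of which
  -- `hrefl` applies.
  have hμσ : scalarPerm μ * frobeniusPerm F p ∈ (M.map G.subtype).map φ :=
    hmem _ μ hμ1 (fun x => rfl)
      (hHa ▸ mul_mem (Subgroup.subset_closure (by simp)) (Subgroup.subset_closure (by simp)))
  have hHM : H.map φ ≤ (M.map G.subtype).map φ := by
    rw [hHa, Subgroup.closure_le]
    rintro _ (rfl | rfl)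
    · exact hσ
    · exact (Subgroup.mul_mem_cancel_right _ hσ).1 hμσ
  rw [Subgroup.map_le_map_iff_of_injective hφinj] at hHM
  refine (Subgroup.eq_top_iff' M).2 fun g => ?_
  have h1 : (g : Equiv.Perm F) ∈ M.map G.subtype := by
    rw [eq_translationHom_mul_linearPart hG hV hH g]
    exact mul_mem ⟨_, hVM (translationHom_mem hV _), rfl⟩ (hHM (Subtype.property _))
  obtain ⟨g', hg', hgg'⟩ := h1
  rwa [← Subtype.ext hgg']

end

theorem theorem2 (p f : ℕ) [Fact p.Prime] (hf : 0 < f)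
    (F : Type*) [Field F] [Finite F] [CharP F p] (hq : Nat.card F = p ^ f)
    (lam : Fˣ) (hlam : ∀ x : Fˣ, x ∈ Subgroup.zpowers lam)
    (G H : Subgroup (Equiv.Perm F))
    (hG : G ≤ affineSemilinearGroup F)
    (hV : translationGroup F ≤ G)
    (hprim : MulAction.IsPreprimitive G F)
    (hH : H = G ⊓ MulAction.stabilizer (Equiv.Perm F) (0 : F))
    (hcyc : ¬ IsCyclic G) :
    IsNonBasicOfAffineType G ↔
      p ≡ 3 [MOD 4] ∧ f = 2 ∧ (IsPGroup 2 H ∧ IsDihedral H) ∧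
        ∃ e : ℕ, e ∣ p + 1 ∧ ∃ a : Fˣ,
          H.map (MulAut.conj (scalarPerm a)).toMonoidHom =
            Subgroup.closure {frobeniusPerm F p, scalarPerm (lam ^ ((p - 1) * e))} := by
  rw [isNonBasicOfAffineType_iff hG hV hprim hH]
  constructor
  · rintro ⟨hcovH, hcovG⟩
    exact stabilizer_eq_dihedral_of_not_hasTwoCover hf hq lam hlam hG hV hprim hH hcyc hcovH hcovG
  · rintro ⟨-, rfl, ⟨hH2, -⟩, e, -, a, hHa⟩
    exact ⟨hH2.not_hasTwoCover,
      not_hasTwoCover_of_isPGroup_stabilizer hq lam hG hV hprim hH hH2 hHa⟩
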